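/- Let $d\ge 1$, $\alpha=(\alpha_1,\dots,\alpha_d)$ with all $\alpha_i>0$, and write $|z|=\sum_i z_i$ for a vector $z$, $a_{(k)}=a(a+1)\cdots(a+k-1)$ for the rising factorial, and $v_{(r)}=\prod_i (v_i)_{(r_i)}$ for vectors. For $n\in\mathbb N^d$ ($\mathbb N\ni 0$) let $n'=(n_1,\dots,n_{d-1})$. **Measures.** $\gamma_\alpha^d$ is the law of $d$ independent Gamma variables with shapes $\alpha_1,\dots,\alpha_d$ and scale $1$. $D_\alpha$ is the Dirichlet distribution on $\Delta_{(d-1)}=\{t\in[0,1]^{d-1}:|t|\le 1\}$, with density $\frac{\Gamma(|\alpha|)}{\prod_i\Gamma(\alpha_i)}\prod_{i<d}t_i^{\alpha_i-1}(1-|t|)^{\alpha_d-1}$ (a point mass if $d=1$). $DM_\alpha(m)=\frac{|m|!}{m_1!\cdots m_d!}\,\frac{\alpha_{(m)}}{|\alpha|_{(|m|)}}$ is the Dirichlet-multinomial probability of $m\in\mathbb N^d$. **Polynomials.** For $a,b>0$ and $k\in\mathbb N$ let $L_k^{a}(y)=\frac{a_{(k)}}{k!}\,{}_1F_1(-k;a;y)$,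 and let $R_k^{a,b}$ be the Jacobi polynomial of degree $k$ orthogonal with respect to the Beta$(a,b)$ distribution on $[0,1]$, normalized by $R_k^{a,b}(1)=1$, that is, $R_k^{a,b}(x)={}_2F_1(-k,k+a+b-1;b;1-x)$. For $n'\in\mathbb N^{d-1}$ put $A_j=\sum_{i=j+1}^{d}\alpha_i$, $N_j=\sum_{i=j+1}^{d-1}n_i$, $s_j=\sum_{i=1}^{j}x_i$, and $$R^\alpha_{n'}(x)=\prod_{j=1}^{d-1}R_{n_j}^{\alpha_j,\,A_j+2N_j}\!\Big(\frac{x_j}{1-s_{j-1}}\Big)(1-s_{j-1})^{n_j}.$$ For $y\in\mathbb R_+^d$ and $m,n\in\mathbb N^d$ put $$L^\alpha_m(y)=\prod_{i=1}^d L^{\alpha_i}_{m_i}(y_i),\qquad L^{\alpha*}_n(y)=L_{n_d}^{|\alpha|+2|n'|}(|y|)\,|y|^{|n'|}\,R^\alpha_{n'}\!\Big(\frac{y}{|y|}\Big),$$ where $R^\alpha_{n'}$ is evaluated at the first $d-1$ coordinates of $y/|y|$. **Lauricella function.** For $b,c,z$ with $r$ coordinates, $F_A(a;b;c;z)=\sum_{p\in\mathbb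 N^r}\frac{a_{(|p|)}\,b_{(p)}}{c_{(p)}\,p_1!\cdots p_r!}\,z^p$ (all the series below are finite sums). **Statement.** For all $m,n\in\mathbb N^d$ the product $L^{\alpha*}_nL^\alpha_m$ is $\gamma^d_\alpha$-integrable, the integrands on the right below are $D_\alpha$-integrable for every $j\in\mathbb N$, and the connection coefficient $c^*_m(n):=\int L^{\alpha*}_n L^{\alpha}_m\,d\gamma^d_\alpha$ satisfies $$c^*_m(n)=\delta_{|m||n|}\,\frac{|\alpha|_{(|n|)}}{|n|!}\,DM_\alpha(m)\sum_{j=0}^{|n|}\frac{|\alpha|_{(j)}}{j!}\,d_j\int_{\Delta_{(d-1)}}R^\alpha_{n'}(t)\,F_A\big(|\alpha|;-m,-j;\alpha,|\alpha|;t,1-|t|,1\big)\,D_\alpha(dt),$$ where $$d_j=\sum_{i=0}^{|n'|}(-|n'|)_{(i)}\,\frac{|\alpha|_{(|n'|)}\,(|\alpha|+2|n'|)_{(n_d)}}{i!\,n_d!}\,F_A\big(|\alpha|;-i,-n_d,-j;|\alpha|,|\alpha|+2|n'|,|\alpha|;1,1,1\big).$$ -/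

import Mathlib

open MeasureTheory ProbabilityTheory

noncomputable section

namespace LaguerreJacobi

/-- The rising factorial `a (a + 1) ⋯ (a + n - 1)`. -/
def rising (a : ℝ) (n : ℕ) : ℝ := (ascPochhammer ℝ n).eval a

/-- The confluent hypergeometric series `₁F₁(a; c; z)`. -/
def oneFOne (a c z : ℝ) : ℝ :=
  ∑' i : ℕ, rising a i / rising c i * z ^ i / (i.factorial : ℝ)

/-- The Lauricella function `F_A(a; b; c; z)` in `r` variables, as a sum over multi-indices. -/
def lauricellaFA {r : ℕ} (a : ℝ) (b c z : Fin r → ℝ) : ℝ :=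
  ∑' p : Fin r → ℕ, rising a (∑ i, p i) *
    ∏ i, (rising (b i) (p i) / rising (c i) (p i) * z i ^ p i / ((p i).factorial : ℝ))

/-- The Laguerre polynomial `L_n^a`, orthogonal for the Gamma distribution of shape `a > 0` and
scale `1` (so `a = a' + 1` with `a'` the parameter of the usual convention). -/
def laguerre (n : ℕ) (a y : ℝ) : ℝ :=
  rising a n / (n.factorial : ℝ) * oneFOne (-(n : ℝ)) a y

/-- The classical Jacobi polynomial on `[-1, 1]`, with weight `(1 - x) ^ a * (1 + x) ^ b`. -/
def jacobiClassical (n : ℕ) (a b x : ℝ) : ℝ :=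
  rising (a + 1) n / (n.factorial : ℝ) *
    ordinaryHypergeometric (-(n : ℝ)) ((n : ℝ) + a + b + 1) (a + 1) ((1 - x) / 2)

/-- The shifted monic Jacobi polynomial, orthogonal for the Beta distribution with parameters
`a, b > 0` on `[0, 1]`. -/
def jacobiShifted (n : ℕ) (a b x : ℝ) : ℝ :=
  (n.factorial : ℝ) / rising (a + b + (n : ℝ) - 1) n * jacobiClassical n (b - 1) (a - 1) (2 * x - 1)

/-- The shifted Jacobi polynomial `R_n^{a, b}`, standardized to take the value `1` at `1`. -/
def jacobiR (n : ℕ) (a b x : ℝ) : ℝ :=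
  jacobiShifted n a b x / jacobiShifted n a b 1

/-- The simplex of all `x` with nonnegative coordinates of sum at most `1`. For `k = 0` it is a
single point. -/
def simplex (k : ℕ) : Set (Fin k → ℝ) := {x | (∀ i, 0 ≤ x i) ∧ ∑ i, x i ≤ 1}

/-- The Dirichlet density (to be used on the simplex), where the last of the `k + 1` barycentric
coordinates is `1 - ∑ i, x i`. -/
def dirichletDensity {k : ℕ} (α : Fin (k + 1) → ℝ) (x : Fin k → ℝ) : ℝ :=
  Real.Gamma (∑ i, α i) / (∏ i, Real.Gamma (α i)) *
    (∏ i : Fin k, x i ^ (α i.castSucc - 1)) * (1 - ∑ i, x i) ^ (α (Fin.last k) - 1)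

/-- The Dirichlet distribution on the simplex. -/
def dirichlet {k : ℕ} (α : Fin (k + 1) → ℝ) : Measure (Fin k → ℝ) :=
  ((volume : Measure (Fin k → ℝ)).restrict (simplex k)).withDensity
    (fun x => ENNReal.ofReal (dirichletDensity α x))

/-- The probability mass function of the Dirichlet-multinomial distribution. -/
def dirichletMultinomial {k : ℕ} (α : Fin (k + 1) → ℝ) (m : Fin (k + 1) → ℕ) : ℝ :=
  (Nat.multinomial Finset.univ m : ℝ) * (∏ i, rising (α i) (m i)) / rising (∑ i, α i) (∑ i, m i)

/-- The multivariate Jacobi polynomial `R_n^α`, `n ∈ ℕ^k`, for the Dirichlet distribution: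
`∏ j, R_{n_j}^{α_j, A_j + 2 N_j} (x_j / (1 - s_{j-1})) * (1 - s_{j-1}) ^ n_j` with
`A_j = ∑ i > j, α_i`, `N_j = ∑ i > j, n_i` and `s_{j-1} = ∑ i < j, x_i`. Each factor is a polynomial
in `x_j` and `1 - s_{j-1}`; the quotient is meaningful where `s_{j-1} ≠ 1`, that is almost
everywhere on the simplex. -/
def jacobiMulti {k : ℕ} (α : Fin (k + 1) → ℝ) (n : Fin k → ℕ) (x : Fin k → ℝ) : ℝ :=
  ∏ j : Fin k,
    (jacobiR (n j) (α j.castSucc)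
        ((∑ i ∈ Finset.Ioi j.castSucc, α i) + 2 * ((∑ i ∈ Finset.Ioi j, n i : ℕ) : ℝ))
        (x j / (1 - ∑ i ∈ Finset.Iio j, x i))
      * (1 - ∑ i ∈ Finset.Iio j, x i) ^ n j)

/-- The law of `k + 1` independent Gamma variables of shapes `α i` and scale `1`. -/
def gammaProd {k : ℕ} (α : Fin (k + 1) → ℝ) : Measure (Fin (k + 1) → ℝ) :=
  Measure.pi fun i => gammaMeasure (α i) 1

/-- The first `k` entries of a multi-index in `ℕ^(k+1)`. -/
def front {k : ℕ} (n : Fin (k + 1) → ℕ) : Fin k → ℕ := fun j => n j.castSucc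

/-- The product Laguerre system. -/
def laguerreProd {k : ℕ} (α : Fin (k + 1) → ℝ) (m : Fin (k + 1) → ℕ) (y : Fin (k + 1) → ℝ) : ℝ :=
  ∏ i, laguerre (m i) (α i) (y i)

/-- The Jacobi-Laguerre system
`L_{n_d}^{|α| + 2|n'|} (|y|) * |y| ^ |n'| * R_{n'}^α (y / |y|)`, with `|y| = ∑ i, y i`. -/
def laguerreStar {k : ℕ} (α : Fin (k + 1) → ℝ) (n : Fin (k + 1) → ℕ) (y : Fin (k + 1) → ℝ) : ℝ :=
  laguerre (n (Fin.last k)) ((∑ i, α i) + 2 * ((∑ j, front n j : ℕ) : ℝ)) (∑ i, y i)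
    * (∑ i, y i) ^ (∑ j, front n j)
    * jacobiMulti α (front n) (fun j => y j.castSucc / ∑ i, y i)

/-- The connection coefficient `c*_m(n)`, the expectation of `L^{α*}_n(Y) L^α_m(Y)` for a vector `Y`
of independent Gamma variables. -/
def connectionCoeff {k : ℕ} (α : Fin (k + 1) → ℝ) (m n : Fin (k + 1) → ℕ) : ℝ :=
  ∫ y, laguerreStar α n y * laguerreProd α m y ∂(gammaProd α)

/-- The weights `d_j`. -/
def weightD {k : ℕ} (α : Fin (k + 1) → ℝ) (n : Fin (k + 1) → ℕ) (j : ℕ) : ℝ :=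
  let a : ℝ := ∑ i, α i
  let N : ℕ := ∑ l, front n l
  let nd : ℕ := n (Fin.last k)
  ∑ i ∈ Finset.range (N + 1),
    rising (-(N : ℝ)) i * (rising a N * rising (a + 2 * (N : ℝ)) nd)
        / ((i.factorial : ℝ) * (nd.factorial : ℝ))
      * lauricellaFA a ![-(i : ℝ), -(nd : ℝ), -(j : ℝ)] ![a, a + 2 * (N : ℝ), a] ![1, 1, 1]

/-- The function `F_A(|α|; -m, -j; α, |α|; t, 1 - |t|, 1)` of `t` in the simplex. -/
def mixtureFA {k : ℕ} (α : Fin (k + 1) → ℝ) (m : Fin (k + 1) → ℕ) (j : ℕ) (t : Fin k → ℝ) : ℝ :=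
  lauricellaFA (∑ i, α i)
    (Fin.snoc (α := fun _ : Fin (k + 2) => ℝ) (fun i : Fin (k + 1) => -(m i : ℝ)) (-(j : ℝ)))
    (Fin.snoc (α := fun _ : Fin (k + 2) => ℝ) α (∑ i, α i))
    (Fin.snoc (α := fun _ : Fin (k + 2) => ℝ)
      (Fin.snoc (α := fun _ : Fin (k + 1) => ℝ) t (1 - ∑ i, t i)) 1)

end LaguerreJacobi

end

open LaguerreJacobi

/-! Almost everywhere both integrands are polynomials, so integration against Gamma laws reduces to
the linear functionals `gammaFunctional` and `gammaFunctionalMv`, which send a monomial to a product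
of rising factorials.

The factor `δ` comes from degrees: each of the two systems is orthogonal to every polynomial of
total degree below its own. All the orthogonality rests on one fact: an alternating binomial sum of
polynomial values is an `n`-th finite difference, which kills degrees below `n`.

For the formula itself, write `Y = S t` with `S = |Y|` of Gamma law with shape `a = |α|`,
independent of the Dirichlet vector `t`. For fixed `t`, what is averaged over `S` is `R(t) Q(S)
W_t(S)`, where `Q(S) = S^N L_{n_d}^{a+2N}(S)` with `N = |n'|`, and `W_t(S)` is the product of the
`₁F₁(-m_i; α_i; t_i S)`, up to the constant that normalizes `L_m^α`. Since `Q` has degree at most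
`|n|`, it expands in the polynomials `K_j = ₁F₁(-j; a; S)`, `j ≤ |n|`, which are orthogonal with
squared norms `j!/a_(j)`. A Lauricella function with negative integer parameters is the Gamma mean
of a product of such `₁F₁` (`lauricellaFA_neg`). Hence `E[Q K_j]` is `d_j` (`weightD_eq`), `E[K_j
W_t]` is the function `F_A` under the integral (`mixtureFA_eq`), and integrating over `t` gives
`sum_weightD_mul_integral`. -/

/-! ### Rising factorials and finite differences -/

theorem rising_zero (a : ℝ) : rising a 0 = 1 := by simp [rising]

theorem rising_pos {a : ℝ} (ha : 0 < a) (n : ℕ) : 0 < rising a n := ascPochhammer_pos n a ha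

theorem rising_add (a : ℝ) (p q : ℕ) : rising a (p + q) = rising a p * rising (a + p) q := by
  simp [rising, ← ascPochhammer_mul]

theorem rising_succ (a : ℝ) (n : ℕ) : rising a (n + 1) = rising a n * (a + n) := by
  simp [rising, ascPochhammer_succ_eval]

theorem rising_mul_rising_comm (a : ℝ) (p q : ℕ) :
    rising a p * rising (a + p) q = rising a q * rising (a + q) p := by
  rw [← rising_add, ← rising_add, add_comm]

theorem rising_neg (n q : ℕ) : rising (-(n : ℝ)) q = (-1) ^ q * (q.factorial * n.choose q) := by
  rw [rising, ascPochhammer_eval_neg_eq_descPochhammer, ← Nat.cast_mul,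
    ← Nat.descFactorial_eq_factorial_mul_choose, descPochhammer_eval_eq_descFactorial]

theorem rising_neg_eq_zero {n q : ℕ} (h : n < q) : rising (-(n : ℝ)) q = 0 := by
  simp [rising_neg, Nat.choose_eq_zero_of_lt h]

theorem rising_neg_div (n q : ℕ) :
    rising (-(n : ℝ)) q / q.factorial = (-1) ^ q * n.choose q := by
  rw [rising_neg]
  field_simp

/-- `rising (a + q) p` as a polynomial in `q`. -/
noncomputable def risingShift (a : ℝ) (p : ℕ) : Polynomial ℝ :=
  (ascPochhammer ℝ p).comp (Polynomial.X + Polynomial.C a)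

theorem risingShift_eval (a : ℝ) (p : ℕ) (x : ℝ) : (risingShift a p).eval x = rising (a + x) p := by
  simp [risingShift, rising, add_comm]

theorem risingShift_natDegree (a : ℝ) (p : ℕ) : (risingShift a p).natDegree = p := by
  simp [risingShift, Polynomial.natDegree_comp]

theorem risingShift_monic (a : ℝ) (p : ℕ) : (risingShift a p).Monic :=
  (monic_ascPochhammer ℝ p).comp (Polynomial.monic_X_add_C a) (by simp)

/-- The weights are signed binomial coefficients. Every orthogonality relation below is brought to
this form with a polynomial `f`. -/
theorem sum_rising_neg_eq (n : ℕ) (f : ℝ → ℝ) :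
    ∑ q ∈ Finset.range (n + 1), rising (-(n : ℝ)) q / q.factorial * f q =
      (-1) ^ n * (fwdDiff 1)^[n] f 0 := by
  rw [fwdDiff_iter_eq_sum_shift, Finset.mul_sum]
  refine Finset.sum_congr rfl fun q hq => ?_
  have h : (-1 : ℝ) ^ n * (-1) ^ (n - q) = (-1) ^ q := by
    have hq : q ≤ n := by simpa [Nat.lt_succ_iff] using hq
    obtain ⟨r, rfl⟩ := Nat.exists_eq_add_of_le hq
    rw [Nat.add_sub_cancel_left, pow_add, mul_assoc, ← mul_pow]
    simp
  rw [rising_neg_div]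
  simp only [zsmul_eq_mul, nsmul_eq_mul, zero_add, mul_one]
  push_cast
  rw [← h]
  ring

theorem sum_rising_neg_mul_eval_eq_zero {n : ℕ} {P : Polynomial ℝ} (hP : P.natDegree < n) :
    ∑ q ∈ Finset.range (n + 1), rising (-(n : ℝ)) q / q.factorial * P.eval (q : ℝ) = 0 := by
  rw [sum_rising_neg_eq n fun x => P.eval x, Polynomial.fwdDiff_iter_eq_zero_of_degree_lt hP]
  simp

theorem sum_rising_neg_mul_eval {n : ℕ} {P : Polynomial ℝ} (hP : P.natDegree = n) :
    ∑ q ∈ Finset.range (n + 1), rising (-(n : ℝ)) q / q.factorial * P.eval (q : ℝ) =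
      (-1) ^ n * (P.leadingCoeff * n.factorial) := by
  subst hP
  rw [sum_rising_neg_eq _ fun x => P.eval x, Polynomial.fwdDiff_iter_degree_eq_factorial]
  simp

/-! ### Orthogonality and expansions for the Gamma law in one variable -/

/-- The functional `X ^ l ↦ rising a l`: the expectation for the Gamma law of shape `a`. -/
noncomputable def gammaFunctional (a : ℝ) : Polynomial ℝ →ₗ[ℝ] ℝ :=
  Polynomial.lsum fun l => LinearMap.mulLeft ℝ (rising a l)

theorem gammaFunctional_monomial (a : ℝ) (l : ℕ) (c : ℝ) :
    gammaFunctional a (Polynomial.monomial l c) = rising a l * c := by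
  simp [gammaFunctional, Polynomial.lsum_apply]

theorem gammaFunctional_X_pow (a : ℝ) (l : ℕ) :
    gammaFunctional a (Polynomial.X ^ l) = rising a l := by
  rw [Polynomial.X_pow_eq_monomial, gammaFunctional_monomial, mul_one]

theorem gammaFunctional_C_mul (a c : ℝ) (P : Polynomial ℝ) :
    gammaFunctional a (Polynomial.C c * P) = c * gammaFunctional a P := by
  rw [Polynomial.C_mul', map_smul, smul_eq_mul]

/-- The coefficients of the terminating series `₁F₁(-n; c; x)`. -/
noncomputable def kummerCoeff (n : ℕ) (c : ℝ) (i : ℕ) : ℝ :=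
  rising (-(n : ℝ)) i / rising c i / i.factorial

/-- The terminating series `₁F₁(-n; c; X)` as a polynomial. -/
noncomputable def kummer (n : ℕ) (c : ℝ) : Polynomial ℝ :=
  ∑ i ∈ Finset.range (n + 1), Polynomial.C (kummerCoeff n c i) * Polynomial.X ^ i

theorem kummerCoeff_eq (n : ℕ) (c : ℝ) (i : ℕ) :
    kummerCoeff n c i = rising (-(n : ℝ)) i / i.factorial / rising c i := by
  rw [kummerCoeff, div_right_comm]

theorem kummer_coeff (n : ℕ) (c : ℝ) (i : ℕ) : (kummer n c).coeff i = kummerCoeff n c i := by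
  simp only [kummer, Polynomial.finsetSum_coeff, Polynomial.coeff_C_mul_X_pow,
    Finset.sum_ite_eq, Finset.mem_range]
  split_ifs with h
  · rfl
  · rw [kummerCoeff, rising_neg_eq_zero (by omega)]
    simp

theorem kummer_natDegree_le (n : ℕ) (c : ℝ) : (kummer n c).natDegree ≤ n :=
  Polynomial.natDegree_sum_le_of_forall_le _ _ fun i hi =>
    (Polynomial.natDegree_C_mul_X_pow_le _ _).trans (by simpa [Nat.lt_succ_iff] using hi)

/-- Splitting `rising a (q + l)` at `q` cancels the denominator of the Kummer coefficient and leaves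
a polynomial of degree `l` in `q`. -/
theorem gammaFunctional_kummer_mul_X_pow {a : ℝ} (ha : 0 < a) (n l : ℕ) :
    gammaFunctional a (kummer n a * Polynomial.X ^ l) =
      ∑ q ∈ Finset.range (n + 1), rising (-(n : ℝ)) q / q.factorial *
        (risingShift a l).eval (q : ℝ) := by
  rw [kummer, Finset.sum_mul, map_sum]
  refine Finset.sum_congr rfl fun q _ => ?_
  rw [mul_assoc, ← pow_add, gammaFunctional_C_mul, gammaFunctional_X_pow, rising_add,
    risingShift_eval, kummerCoeff_eq]
  have := (rising_pos ha q).ne'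
  field_simp

theorem gammaFunctional_kummer_mul_eq_zero {a : ℝ} (ha : 0 < a) {n : ℕ} {P : Polynomial ℝ}
    (hP : P.natDegree < n) : gammaFunctional a (kummer n a * P) = 0 := by
  rw [P.as_sum_range_C_mul_X_pow, Finset.mul_sum, map_sum]
  refine Finset.sum_eq_zero fun l hl => ?_
  rw [mul_left_comm, gammaFunctional_C_mul, gammaFunctional_kummer_mul_X_pow ha,
    sum_rising_neg_mul_eval_eq_zero, mul_zero]
  rw [risingShift_natDegree]
  have := Finset.mem_range.1 hl
  omega

theorem gammaFunctional_kummer_mul_kummer {a : ℝ} (ha : 0 < a) (i j : ℕ) :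
    gammaFunctional a (kummer i a * kummer j a) =
      if i = j then (i.factorial : ℝ) / rising a i else 0 := by
  split_ifs with h
  · subst h
    -- Only one factor is expanded: its powers below `i` are killed by the other, and its top power
    -- gives the `i`-th difference of a monic polynomial of degree `i`.
    nth_rw 2 [kummer]
    rw [Finset.mul_sum, map_sum, Finset.sum_range_succ, Finset.sum_eq_zero, zero_add]
    · rw [mul_left_comm, gammaFunctional_C_mul, gammaFunctional_kummer_mul_X_pow ha,
        sum_rising_neg_mul_eval (risingShift_natDegree a i), (risingShift_monic a i).leadingCoeff,
        kummerCoeff_eq, rising_neg_div]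
      have h : ((-1 : ℝ) ^ i) * (-1) ^ i = 1 := by rw [← mul_pow]; simp
      simp only [Nat.choose_self, Nat.cast_one, mul_one, one_mul]
      rw [div_mul_eq_mul_div, ← mul_assoc, h, one_mul]
    · intro l hl
      rw [mul_left_comm, gammaFunctional_C_mul, gammaFunctional_kummer_mul_X_pow ha,
        sum_rising_neg_mul_eval_eq_zero, mul_zero]
      rw [risingShift_natDegree]
      simpa using hl
  · rcases lt_or_gt_of_ne h with h | h
    · rw [mul_comm]
      exact gammaFunctional_kummer_mul_eq_zero ha ((kummer_natDegree_le i a).trans_lt h)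
    · exact gammaFunctional_kummer_mul_eq_zero ha ((kummer_natDegree_le j a).trans_lt h)

/-- Binomial inversion: up to sign, `rising (-i) q` is a falling factorial, monic of degree `q` in
`i`. For `q < n` the difference vanishes, and for `q > n` every term does. -/
theorem sum_rising_neg_mul_rising_neg (n q : ℕ) :
    ∑ i ∈ Finset.range (n + 1), rising (-(n : ℝ)) i / i.factorial * rising (-(i : ℝ)) q =
      if q = n then (n.factorial : ℝ) else 0 := by
  have key : ∀ i : ℕ, rising (-(i : ℝ)) q = (-1) ^ q * (descPochhammer ℝ q).eval (i : ℝ) :=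
    fun i => ascPochhammer_eval_neg_eq_descPochhammer ℝ (i : ℝ) q
  have hcong : ∑ i ∈ Finset.range (n + 1), rising (-(n : ℝ)) i / i.factorial * rising (-(i : ℝ)) q =
      (-1) ^ q * ∑ i ∈ Finset.range (n + 1),
        rising (-(n : ℝ)) i / i.factorial * (descPochhammer ℝ q).eval (i : ℝ) := by
    rw [Finset.mul_sum]
    refine Finset.sum_congr rfl fun i _ => ?_
    rw [key]
    ring
  rcases lt_trichotomy q n with h | h | h
  · rw [hcong, sum_rising_neg_mul_eval_eq_zero (by rwa [descPochhammer_natDegree]), if_neg h.ne,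
      mul_zero]
  · rw [hcong, sum_rising_neg_mul_eval (by rw [descPochhammer_natDegree, h]), if_pos h,
      (monic_descPochhammer ℝ q).leadingCoeff, h, ← mul_assoc, ← mul_pow]
    simp
  · rw [if_neg h.ne']
    refine Finset.sum_eq_zero fun i hi => ?_
    rw [rising_neg_eq_zero (n := i) (by have := Finset.mem_range.1 hi; omega), mul_zero]

/-- Inverts the triangular coefficient matrix of the `kummer i a`. This expansion is the source of
the sum over `i` in `d_j`. -/
theorem X_pow_eq_sum_kummer {a : ℝ} (ha : 0 < a) (n : ℕ) :
    (Polynomial.X ^ n : Polynomial ℝ) = ∑ i ∈ Finset.range (n + 1),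
      Polynomial.C (rising a n * (rising (-(n : ℝ)) i / i.factorial)) * kummer i a := by
  ext q
  simp only [Polynomial.finsetSum_coeff, Polynomial.coeff_C_mul, kummer_coeff,
    Polynomial.coeff_X_pow]
  have : ∀ i ∈ Finset.range (n + 1),
      rising a n * (rising (-(n : ℝ)) i / i.factorial) * kummerCoeff i a q =
        rising a n / rising a q / q.factorial *
          (rising (-(n : ℝ)) i / i.factorial * rising (-(i : ℝ)) q) := fun i _ => by
    rw [kummerCoeff]
    ring
  rw [Finset.sum_congr rfl this, ← Finset.mul_sum, sum_rising_neg_mul_rising_neg]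
  split_ifs with h
  · subst h
    have := (rising_pos ha q).ne'
    field_simp
  · simp

/-- The expansion of a polynomial in the orthogonal system of the polynomials `kummer j a`. -/
theorem sum_gammaFunctional_mul_kummer {a : ℝ} (ha : 0 < a) {M : ℕ} {Q : Polynomial ℝ}
    (hQ : Q.natDegree ≤ M) :
    ∑ j ∈ Finset.range (M + 1),
      Polynomial.C (rising a j / j.factorial * gammaFunctional a (Q * kummer j a)) * kummer j a =
        Q := by
  have hk : ∀ i ≤ M, ∑ j ∈ Finset.range (M + 1),
      Polynomial.C (rising a j / j.factorial * gammaFunctional a (kummer i a * kummer j a)) *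
        kummer j a = kummer i a := by
    intro i hi
    rw [Finset.sum_eq_single i]
    · rw [gammaFunctional_kummer_mul_kummer ha, if_pos rfl]
      have := (rising_pos ha i).ne'
      rw [show rising a i / (i.factorial : ℝ) * (i.factorial / rising a i) = 1 by field_simp]
      simp
    · intro j _ hj
      rw [gammaFunctional_kummer_mul_kummer ha, if_neg hj.symm]
      simp
    · intro h
      exact absurd (Finset.mem_range.2 (by omega)) h
  -- The orthogonal projection as a linear map: it fixes each `kummer i a` with `i ≤ M`, hence each
  -- `X ^ l` with `l ≤ M`, hence `Q`.
  let T : Polynomial ℝ →ₗ[ℝ] Polynomial ℝ := ∑ j ∈ Finset.range (M + 1),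
    (((rising a j / j.factorial) • gammaFunctional a).comp
      (LinearMap.mulRight ℝ (kummer j a))).smulRight (kummer j a)
  have hT : ∀ P, T P = ∑ j ∈ Finset.range (M + 1),
      Polynomial.C (rising a j / j.factorial * gammaFunctional a (P * kummer j a)) *
        kummer j a := by
    intro P
    rw [LinearMap.sum_apply]
    refine Finset.sum_congr rfl fun j _ => ?_
    rw [Polynomial.C_mul']
    rfl
  rw [← hT]
  have hX : ∀ l ≤ M, T (Polynomial.X ^ l) = Polynomial.X ^ l := by
    intro l hl
    rw [X_pow_eq_sum_kummer ha l, map_sum]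
    refine Finset.sum_congr rfl fun i hi => ?_
    rw [Polynomial.C_mul', map_smul, hT, hk i (by have := Finset.mem_range.1 hi; omega)]
  rw [Q.as_sum_range_C_mul_X_pow, map_sum]
  refine Finset.sum_congr rfl fun l hl => ?_
  rw [Polynomial.C_mul', map_smul, hX l (by have := Finset.mem_range.1 hl; omega)]

/-! ### Terminating hypergeometric series as polynomials -/

/-- The only factor coupling the indices, `rising a (∑ i, p i)`, is the value of the functional at
`X ^ ∑ i, p i`. Under the functional the multiple sum therefore factors. -/
theorem lauricellaFA_neg {r : ℕ} (a : ℝ) (m : Fin r → ℕ) (c z : Fin r → ℝ) :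
    lauricellaFA a (fun i => -(m i : ℝ)) c z =
      gammaFunctional a (∏ i, (kummer (m i) (c i)).comp (Polynomial.C (z i) * Polynomial.X)) := by
  rw [lauricellaFA, tsum_eq_sum (s := Fintype.piFinset fun i => Finset.range (m i + 1))]
  · simp only [kummer, Polynomial.sum_comp, Polynomial.mul_comp, Polynomial.C_comp,
      Polynomial.X_pow_comp, mul_pow]
    rw [Finset.prod_univ_sum, map_sum]
    refine Finset.sum_congr rfl fun p _ => ?_
    have : ∏ i, Polynomial.C (kummerCoeff (m i) (c i) (p i)) *
        (Polynomial.C (z i) ^ p i * Polynomial.X ^ p i) =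
        Polynomial.C (∏ i, kummerCoeff (m i) (c i) (p i) * z i ^ p i) *
          Polynomial.X ^ (∑ i, p i) := by
      rw [← Finset.prod_pow_eq_pow_sum, map_prod, ← Finset.prod_mul_distrib]
      refine Finset.prod_congr rfl fun i _ => ?_
      rw [map_mul, map_pow, mul_assoc]
    rw [this, gammaFunctional_C_mul, gammaFunctional_X_pow, mul_comm]
    congr 1
    refine Finset.prod_congr rfl fun i _ => ?_
    rw [kummerCoeff]
    ring
  · intro p hp
    rw [Fintype.mem_piFinset] at hp
    push Not at hp
    obtain ⟨i, hi⟩ := hp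
    rw [Finset.prod_eq_zero (Finset.mem_univ i), mul_zero]
    rw [rising_neg_eq_zero (by simp at hi; omega)]
    simp

theorem oneFOne_neg (n : ℕ) (c z : ℝ) : oneFOne (-(n : ℝ)) c z = (kummer n c).eval z := by
  rw [oneFOne, tsum_eq_sum (s := Finset.range (n + 1))]
  · simp only [kummer, Polynomial.eval_finsetSum, Polynomial.eval_mul, Polynomial.eval_C,
      Polynomial.eval_pow, Polynomial.eval_X]
    refine Finset.sum_congr rfl fun i _ => ?_
    rw [kummerCoeff]
    ring
  · intro i hi
    rw [rising_neg_eq_zero (by simp at hi; omega)]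
    simp

/-- The Laguerre polynomial as an element of `ℝ[X]`. -/
noncomputable def laguerrePoly (n : ℕ) (a : ℝ) : Polynomial ℝ :=
  Polynomial.C (rising a n / n.factorial) * kummer n a

theorem laguerre_eq_eval (n : ℕ) (a y : ℝ) : laguerre n a y = (laguerrePoly n a).eval y := by
  simp [laguerre, laguerrePoly, oneFOne_neg]

/-- The coefficients of `R_n^{a, b}` in powers of `1 - x`. -/
noncomputable def jacobiCoeff (n : ℕ) (a b : ℝ) (l : ℕ) : ℝ :=
  rising (-(n : ℝ)) l * rising (n + a + b - 1) l / rising b l / l.factorial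

theorem jacobiR_eq_sum (n : ℕ) {a b : ℝ} (ha : 0 < a) (hb : 0 < b) (x : ℝ) :
    jacobiR n a b x = ∑ l ∈ Finset.range (n + 1), jacobiCoeff n a b l * (1 - x) ^ l := by
  have hK : ((n.factorial : ℝ) / rising (a + b + n - 1) n) * (rising b n / n.factorial) ≠ 0 := by
    have h1 : rising (a + b + n - 1) n ≠ 0 := by
      -- For `n = 0` the base `a + b - 1` need not be positive, but the product is empty.
      rcases n.eq_zero_or_pos with rfl | hn
      · simp [rising_zero]
      · have : (1 : ℝ) ≤ n := by exact_mod_cast hn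
        exact (rising_pos (by linarith) n).ne'
    have h2 := (rising_pos hb n).ne'
    have h3 : (n.factorial : ℝ) ≠ 0 := by positivity
    positivity
  have hx : ∀ x, jacobiShifted n a b x =
      ((n.factorial : ℝ) / rising (a + b + n - 1) n) * (rising b n / n.factorial) *
        ∑ l ∈ Finset.range (n + 1), jacobiCoeff n a b l * (1 - x) ^ l := by
    intro x
    rw [jacobiShifted, jacobiClassical, ← mul_assoc, ordinaryHypergeometric_eq_tsum]
    rw [show b - 1 + 1 = b by ring, show (n : ℝ) + (b - 1) + (a - 1) + 1 = n + a + b - 1 by ring,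
      show (1 - (2 * x - 1)) / 2 = 1 - x by ring]
    congr 1
    beta_reduce
    rw [tsum_eq_sum (s := Finset.range (n + 1))]
    · refine Finset.sum_congr rfl fun l _ => ?_
      rw [jacobiCoeff, smul_eq_mul]
      simp only [rising]
      field_simp
    · intro l hl
      have := rising_neg_eq_zero (n := n) (q := l) (by simp at hl; omega)
      rw [rising] at this
      simp [this]
  rw [jacobiR, hx, hx 1, mul_div_mul_left _ _ hK]
  have h1 : ∑ l ∈ Finset.range (n + 1), jacobiCoeff n a b l * (1 - (1 : ℝ)) ^ l = 1 := by
    rw [Finset.sum_eq_single 0]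
    · simp [jacobiCoeff, rising_zero]
    · intro l _ hl
      simp [hl]
    · simp
  rw [h1, div_one]

/-! ### The Gamma functional in several variables -/

/-- The functional `X ^ p ↦ ∏ i, rising (α i) (p i)`: the expectation for independent Gamma
variables of shapes `α i`. -/
noncomputable def gammaFunctionalMv {d : ℕ} (α : Fin d → ℝ) : MvPolynomial (Fin d) ℝ →ₗ[ℝ] ℝ :=
  (MvPolynomial.basisMonomials (Fin d) ℝ).constr ℝ fun p => ∏ i, rising (α i) (p i)

theorem gammaFunctionalMv_monomial {d : ℕ} (α : Fin d → ℝ) (p : Fin d →₀ ℕ) (c : ℝ) :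
    gammaFunctionalMv α (MvPolynomial.monomial p c) = c * ∏ i, rising (α i) (p i) := by
  have h := (MvPolynomial.basisMonomials (Fin d) ℝ).constr_basis ℝ
    (fun p => ∏ i, rising (α i) (p i)) p
  rw [MvPolynomial.coe_basisMonomials] at h
  rw [← mul_one c, ← smul_eq_mul c 1, ← MvPolynomial.smul_monomial, map_smul, smul_eq_mul]
  simp only [gammaFunctionalMv, h, smul_eq_mul, mul_one]

theorem gammaFunctionalMv_C_mul {d : ℕ} (α : Fin d → ℝ) (c : ℝ) (P : MvPolynomial (Fin d) ℝ) :
    gammaFunctionalMv α (MvPolynomial.C c * P) = c * gammaFunctionalMv α P := by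
  rw [MvPolynomial.C_mul', map_smul, smul_eq_mul]

/-- Raising the exponent of `X i` by one multiplies the value at a monomial by `α i + p i`. The sum
of these factors over `i` depends only on the degree. Iterated, this is the algebraic form of the
independence of total mass and proportions. -/
theorem gammaFunctionalMv_sum_X_mul {d : ℕ} (α : Fin d → ℝ) {F : MvPolynomial (Fin d) ℝ} {h : ℕ}
    (hF : F.IsHomogeneous h) :
    gammaFunctionalMv α ((∑ i, MvPolynomial.X i) * F) = (∑ i, α i + h) * gammaFunctionalMv α F := by
  have hmon : ∀ (p : Fin d →₀ ℕ) (c : ℝ),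
      gammaFunctionalMv α ((∑ i, MvPolynomial.X i) * MvPolynomial.monomial p c) =
        (∑ i, α i + (∑ i, p i : ℕ)) * gammaFunctionalMv α (MvPolynomial.monomial p c) := by
    intro p c
    rw [Finset.sum_mul, map_sum, Nat.cast_sum, ← Finset.sum_add_distrib, Finset.sum_mul]
    refine Finset.sum_congr rfl fun i _ => ?_
    rw [MvPolynomial.X, MvPolynomial.monomial_mul, gammaFunctionalMv_monomial,
      gammaFunctionalMv_monomial, one_mul, ← Finset.mul_prod_erase _ _ (Finset.mem_univ i),
      ← Finset.mul_prod_erase _ (fun j => rising (α j) (p j)) (Finset.mem_univ i)]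
    have he : ∏ x ∈ Finset.univ.erase i, rising (α x) ((Finsupp.single i 1 + p : Fin d →₀ ℕ) x) =
        ∏ x ∈ Finset.univ.erase i, rising (α x) (p x) := by
      refine Finset.prod_congr rfl fun j hj => ?_
      rw [Finsupp.add_apply, Finsupp.single_eq_of_ne (Finset.ne_of_mem_erase hj), zero_add]
    rw [he, Finsupp.add_apply, Finsupp.single_eq_same, add_comm 1, rising_succ]
    ring
  rw [← F.support_sum_monomial_coeff, Finset.mul_sum, map_sum, map_sum, Finset.mul_sum]
  refine Finset.sum_congr rfl fun p hp => ?_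
  rw [hmon]
  have hd : ∑ i, p i = h := by
    rw [← Finsupp.degree_eq_sum]
    exact (DFunLike.congr_fun Finsupp.degree_eq_weight_one p).trans
      (hF (MvPolynomial.mem_support_iff.1 hp))
  rw [hd]

theorem gammaFunctionalMv_sum_X_pow_mul {d : ℕ} (α : Fin d → ℝ) {F : MvPolynomial (Fin d) ℝ}
    {h : ℕ} (hF : F.IsHomogeneous h) (q : ℕ) :
    gammaFunctionalMv α ((∑ i, MvPolynomial.X i) ^ q * F) =
      rising (∑ i, α i + h) q * gammaFunctionalMv α F := by
  induction q with
  | zero => simp [rising_zero]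
  | succ q ih =>
    have hS : (∑ i : Fin d, (MvPolynomial.X i : MvPolynomial (Fin d) ℝ)).IsHomogeneous 1 :=
      MvPolynomial.IsHomogeneous.sum _ _ _ fun i _ => MvPolynomial.isHomogeneous_X _ i
    rw [pow_succ', mul_assoc, gammaFunctionalMv_sum_X_mul α ((hS.pow q).mul hF), ih, rising_succ]
    push_cast
    ring

theorem gammaFunctionalMv_X_zero_pow_mul_rename {k : ℕ} (α : Fin (k + 1) → ℝ) (p : ℕ)
    (g : MvPolynomial (Fin k) ℝ) :
    gammaFunctionalMv α (MvPolynomial.X 0 ^ p * MvPolynomial.rename Fin.succ g) =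
      rising (α 0) p * gammaFunctionalMv (fun i => α i.succ) g := by
  induction g using MvPolynomial.induction_on' with
  | monomial u c =>
    rw [MvPolynomial.rename_monomial, MvPolynomial.X_pow_eq_monomial, MvPolynomial.monomial_mul,
      gammaFunctionalMv_monomial, gammaFunctionalMv_monomial, Fin.prod_univ_succ]
    have h0 : (Finsupp.single (0 : Fin (k + 1)) p + Finsupp.mapDomain Fin.succ u) 0 = p := by
      rw [Finsupp.add_apply, Finsupp.single_eq_same, Finsupp.mapDomain_of_notMem_range _ _ (by simp),
        add_zero]
    have hs : ∀ i : Fin k,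
        (Finsupp.single (0 : Fin (k + 1)) p + Finsupp.mapDomain Fin.succ u) i.succ = u i := by
      intro i
      rw [Finsupp.add_apply, Finsupp.single_eq_of_ne (Fin.succ_ne_zero i),
        Finsupp.mapDomain_apply (Fin.succ_injective k), zero_add]
    simp only [h0, hs]
    ring
  | add f g hf hg => rw [map_add, mul_add, map_add, map_add, hf, hg, mul_add]

/-! ### Orthogonality of the multivariate Jacobi polynomials -/

/-- The form `w ^ n * R_n^{a, b} (x / w)`, written in terms of `u = w - x` and `w`. -/
noncomputable def jacobiForm {A : Type*} [CommRing A] [Algebra ℝ A] (n : ℕ) (a b : ℝ) (u w : A) :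
    A :=
  ∑ l ∈ Finset.range (n + 1), algebraMap ℝ A (jacobiCoeff n a b l) * (u ^ l * w ^ (n - l))

theorem map_jacobiForm {A B : Type*} [CommRing A] [Algebra ℝ A] [CommRing B] [Algebra ℝ B]
    (f : A →ₐ[ℝ] B) (n : ℕ) (a b : ℝ) (u w : A) :
    f (jacobiForm n a b u w) = jacobiForm n a b (f u) (f w) := by
  simp [jacobiForm]

/-- The homogeneous polynomial which agrees with `jacobiMulti` where the coordinates sum to `1`. -/
noncomputable def jacobiPoly {k : ℕ} (α : Fin (k + 1) → ℝ) (n : Fin k → ℕ) :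
    MvPolynomial (Fin (k + 1)) ℝ :=
  ∏ j : Fin k, jacobiForm (n j) (α j.castSucc)
    ((∑ i ∈ Finset.Ioi j.castSucc, α i) + 2 * ((∑ i ∈ Finset.Ioi j, n i : ℕ) : ℝ))
    (∑ i ∈ Finset.Ioi j.castSucc, MvPolynomial.X i) (∑ i ∈ Finset.Ici j.castSucc, MvPolynomial.X i)

theorem isHomogeneous_jacobiForm {d n : ℕ} (a b : ℝ) {u w : MvPolynomial (Fin d) ℝ}
    (hu : u.IsHomogeneous 1) (hw : w.IsHomogeneous 1) :
    (jacobiForm n a b u w).IsHomogeneous n := by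
  refine MvPolynomial.IsHomogeneous.sum _ _ _ fun l hl => ?_
  have h := (MvPolynomial.isHomogeneous_C (Fin d) (jacobiCoeff n a b l)).mul
    ((hu.pow l).mul (hw.pow (n - l)))
  have hl := Finset.mem_range.1 hl
  rwa [show 0 + (1 * l + 1 * (n - l)) = n by omega] at h

theorem isHomogeneous_jacobiPoly {k : ℕ} (α : Fin (k + 1) → ℝ) (n : Fin k → ℕ) :
    (jacobiPoly α n).IsHomogeneous (∑ j, n j) :=
  MvPolynomial.IsHomogeneous.prod _ _ _ fun _ _ => isHomogeneous_jacobiForm _ _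
    (MvPolynomial.IsHomogeneous.sum _ _ _ fun i _ => MvPolynomial.isHomogeneous_X _ i)
    (MvPolynomial.IsHomogeneous.sum _ _ _ fun i _ => MvPolynomial.isHomogeneous_X _ i)

/-- The factors after the first involve only later variables and parameters, which permits induction
on the number of variables. -/
theorem jacobiPoly_succ {k : ℕ} (α : Fin (k + 2) → ℝ) (n : Fin (k + 1) → ℕ) :
    jacobiPoly α n = jacobiForm (n 0) (α 0)
        ((∑ i : Fin (k + 1), α i.succ) + 2 * ((∑ i : Fin k, n i.succ : ℕ) : ℝ))
        (MvPolynomial.rename Fin.succ (∑ i, MvPolynomial.X i)) (∑ i, MvPolynomial.X i) *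
      MvPolynomial.rename Fin.succ (jacobiPoly (fun i => α i.succ) fun i => n i.succ) := by
  have hIci : Finset.Ici (0 : Fin (k + 2)) = Finset.univ := by ext; simp
  rw [jacobiPoly, Fin.prod_univ_succ, jacobiPoly, map_prod]
  simp only [map_jacobiForm, map_sum, MvPolynomial.rename_X, Fin.castSucc_zero, ← Fin.succ_castSucc,
    Fin.sum_Ioi_succ, Fin.sum_Ici_succ, Fin.sum_Ioi_zero, hIci]

/-- The total sum, the first variable and the sum of the others are integrated out in turn;
homogeneity of what remains fixes each shift. -/
theorem gammaFunctionalMv_jacobi_term {k : ℕ} (α : Fin (k + 1) → ℝ) (l r p : ℕ)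
    {g : MvPolynomial (Fin k) ℝ} {h : ℕ} (hg : g.IsHomogeneous h) :
    gammaFunctionalMv α ((MvPolynomial.rename Fin.succ (∑ i, MvPolynomial.X i)) ^ l *
        (∑ i, MvPolynomial.X i) ^ r * (MvPolynomial.X 0 ^ p * MvPolynomial.rename Fin.succ g)) =
      rising (∑ i, α i + (l + p + h : ℕ)) r * (rising (α 0) p *
        (rising (∑ i : Fin k, α i.succ + h) l * gammaFunctionalMv (fun i => α i.succ) g)) := by
  have hS : (∑ i : Fin k, (MvPolynomial.X i : MvPolynomial (Fin k) ℝ)).IsHomogeneous 1 :=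
    MvPolynomial.IsHomogeneous.sum _ _ _ fun i _ => MvPolynomial.isHomogeneous_X _ i
  have hF : ((MvPolynomial.X 0 : MvPolynomial (Fin (k + 1)) ℝ) ^ p * MvPolynomial.rename Fin.succ
      ((∑ i, MvPolynomial.X i) ^ l * g)).IsHomogeneous (l + p + h) := by
    have := ((MvPolynomial.isHomogeneous_X ℝ (0 : Fin (k + 1))).pow p).mul
      (((hS.pow l).mul hg).rename_isHomogeneous (f := Fin.succ))
    rwa [show 1 * p + (1 * l + h) = l + p + h by ring] at this
  rw [← gammaFunctionalMv_sum_X_pow_mul _ hg, ← gammaFunctionalMv_X_zero_pow_mul_rename,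
    ← gammaFunctionalMv_sum_X_pow_mul _ hF]
  congr 1
  rw [map_mul, map_pow]
  ring

/-- With `e = a + b + p + r` and `n = p + r + 1 + t`, the Jacobi parameter `n + a + b - 1` is `e +
t`. The quotients of rising factorials then recombine into a polynomial in `l` of degree `r + t <
n`. -/
theorem sum_jacobiCoeff_mul_eq_zero {n p r : ℕ} {a b : ℝ} (ha : 0 < a) (hb : 0 < b)
    (h : p + r < n) :
    ∑ l ∈ Finset.range (n + 1), jacobiCoeff n a b l *
      (rising (b + r) l * rising (a + b + (p + r : ℕ) + l) (n - l)) = 0 := by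
  set e : ℝ := a + b + (p + r : ℕ) with he
  have hepos : 0 < e := by positivity
  obtain ⟨t, rfl⟩ : ∃ t, n = p + r + 1 + t := Nat.exists_eq_add_of_lt h |>.imp fun t ht => by omega
  set n := p + r + 1 + t with hn
  have hdeg : (risingShift b r * risingShift e t).natDegree < n := by
    rw [(risingShift_monic b r).natDegree_mul (risingShift_monic e t), risingShift_natDegree,
      risingShift_natDegree]
    omega
  have key : ∀ l ∈ Finset.range (n + 1), jacobiCoeff n a b l *
      (rising (b + r) l * rising (e + l) (n - l)) =
        rising e n / rising e t / rising b r * (rising (-(n : ℝ)) l / l.factorial *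
          (risingShift b r * risingShift e t).eval (l : ℝ)) := by
    intro l hl
    have hl : l ≤ n := by simpa [Nat.lt_succ_iff] using hl
    have h1 : rising e n = rising e l * rising (e + l) (n - l) := by
      rw [← rising_add, Nat.add_sub_cancel' hl]
    have h2 := rising_mul_rising_comm e t l
    have h3 := rising_mul_rising_comm b r l
    have e1 : (n : ℝ) + a + b - 1 = e + t := by rw [he, hn]; push_cast; ring
    have p1 := (rising_pos hepos t).ne'
    have p2 := (rising_pos hepos l).ne'
    have p3 := (rising_pos hb r).ne'
    have p4 := (rising_pos hb l).ne'
    rw [Polynomial.eval_mul, risingShift_eval, risingShift_eval, jacobiCoeff, e1, h1]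
    rw [mul_comm] at h2
    rw [← eq_div_iff p1] at h2
    rw [mul_comm] at h3
    rw [← eq_div_iff p3] at h3
    rw [h2, h3]
    field_simp
  rw [Finset.sum_congr rfl key, ← Finset.mul_sum, sum_rising_neg_mul_eval_eq_zero hdeg, mul_zero]

theorem isHomogeneous_prod_X_pow {d : ℕ} (p : Fin d → ℕ) :
    (∏ i, (MvPolynomial.X i : MvPolynomial (Fin d) ℝ) ^ p i).IsHomogeneous (∑ i, p i) :=
  MvPolynomial.IsHomogeneous.prod _ _ _ fun i _ => by
    simpa using (MvPolynomial.isHomogeneous_X ℝ i).pow (p i)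

theorem gammaFunctionalMv_jacobiPoly_mul_eq_zero {k : ℕ} {α : Fin (k + 1) → ℝ} (hα : ∀ i, 0 < α i)
    (n : Fin k → ℕ) (p : Fin (k + 1) → ℕ) (h : ∑ i, p i < ∑ j, n j) :
    gammaFunctionalMv α (jacobiPoly α n * ∏ i, MvPolynomial.X i ^ p i) = 0 := by
  induction k with
  | zero => simp at h
  | succ k ih =>
    set g : MvPolynomial (Fin (k + 1)) ℝ :=
      jacobiPoly (fun i => α i.succ) (fun i => n i.succ) * ∏ i, MvPolynomial.X i ^ p i.succ with hg
    have hgh : g.IsHomogeneous (∑ i : Fin k, n i.succ + ∑ i : Fin (k + 1), p i.succ) :=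
      (isHomogeneous_jacobiPoly _ _).mul (isHomogeneous_prod_X_pow _)
    have e1 : jacobiPoly α n * ∏ i, MvPolynomial.X i ^ p i =
        jacobiForm (n 0) (α 0)
          ((∑ i : Fin (k + 1), α i.succ) + 2 * ((∑ i : Fin k, n i.succ : ℕ) : ℝ))
          (MvPolynomial.rename Fin.succ (∑ i, MvPolynomial.X i)) (∑ i, MvPolynomial.X i) *
        (MvPolynomial.X 0 ^ p 0 * MvPolynomial.rename Fin.succ g) := by
      rw [jacobiPoly_succ, Fin.prod_univ_succ, hg, map_mul, map_prod]
      simp only [map_pow, MvPolynomial.rename_X]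
      ring
    rw [Fin.sum_univ_succ, Fin.sum_univ_succ (f := n)] at h
    rw [e1, jacobiForm, Finset.sum_mul, map_sum]
    simp only [mul_assoc (MvPolynomial.C _), MvPolynomial.algebraMap_eq, gammaFunctionalMv_C_mul,
      gammaFunctionalMv_jacobi_term α _ _ _ hgh]
    by_cases hlt : ∑ i : Fin (k + 1), p i.succ < ∑ i : Fin k, n i.succ
    · rw [hg, ih (α := fun i => α i.succ) (fun i => hα i.succ) _ _ hlt]
      simp
    -- Here the later variables contribute degree `N + (N + r)`, with `N` the later Jacobi degree.
    -- This produces the shift `2 N` in the Jacobi parameter and leaves the one-variable relation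
    -- with `p 0 + r < n 0`.
    · obtain ⟨r, hr⟩ := Nat.exists_eq_add_of_le (not_lt.1 hlt)
      have hA : 0 < ∑ i : Fin (k + 1), α i.succ := Finset.sum_pos (fun i _ => hα i.succ) (by simp)
      have hb : 0 < ∑ i : Fin (k + 1), α i.succ + 2 * ((∑ i : Fin k, n i.succ : ℕ) : ℝ) := by
        positivity
      have hpr : p 0 + r < n 0 := by omega
      have hz := sum_jacobiCoeff_mul_eq_zero (hα 0) hb hpr
      rw [← zero_mul (rising (α 0) (p 0) * gammaFunctionalMv (fun i => α i.succ) g), ← hz,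
        Finset.sum_mul]
      refine Finset.sum_congr rfl fun l _ => ?_
      rw [hr, Fin.sum_univ_succ α]
      have e2 : α 0 + ∑ i : Fin (k + 1), α i.succ +
          ((l + p 0 + (∑ i : Fin k, n i.succ + (∑ i : Fin k, n i.succ + r)) : ℕ) : ℝ) =
          α 0 + (∑ i : Fin (k + 1), α i.succ + 2 * ((∑ i : Fin k, n i.succ : ℕ) : ℝ)) +
            (p 0 + r : ℕ) + l := by
        push_cast; ring
      have e3 : ∑ i : Fin (k + 1), α i.succ +
          ((∑ i : Fin k, n i.succ + (∑ i : Fin k, n i.succ + r) : ℕ) : ℝ) =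
          ∑ i : Fin (k + 1), α i.succ + 2 * ((∑ i : Fin k, n i.succ : ℕ) : ℝ) + r := by
        push_cast; ring
      rw [e2, e3]
      ring

/-! ### Orthogonality of the two Laguerre systems to lower degrees -/

/-- The Jacobi-Laguerre system in polynomial form. -/
noncomputable def laguerreStarPoly {k : ℕ} (α : Fin (k + 1) → ℝ) (n : Fin (k + 1) → ℕ) :
    MvPolynomial (Fin (k + 1)) ℝ :=
  Polynomial.aeval (∑ i, MvPolynomial.X i)
    (laguerrePoly (n (Fin.last k)) ((∑ i, α i) + 2 * ((∑ j, front n j : ℕ) : ℝ))) *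
      jacobiPoly α (front n)

/-- The product Laguerre system in polynomial form. -/
noncomputable def laguerreProdPoly {k : ℕ} (α : Fin (k + 1) → ℝ) (m : Fin (k + 1) → ℕ) :
    MvPolynomial (Fin (k + 1)) ℝ :=
  ∏ i, Polynomial.aeval (MvPolynomial.X i) (laguerrePoly (m i) (α i))

theorem totalDegree_aeval_le {d : ℕ} (P : Polynomial ℝ) {u : MvPolynomial (Fin d) ℝ}
    (hu : u.totalDegree ≤ 1) : (Polynomial.aeval u P).totalDegree ≤ P.natDegree := by
  rw [Polynomial.aeval_eq_sum_range]
  refine MvPolynomial.totalDegree_finsetSum_le fun l hl => ?_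
  refine (MvPolynomial.totalDegree_smul_le _ _).trans ((MvPolynomial.totalDegree_pow _ _).trans ?_)
  have := Finset.mem_range.1 hl
  calc l * u.totalDegree ≤ l * 1 := Nat.mul_le_mul_left _ hu
    _ ≤ _ := by omega

theorem laguerrePoly_natDegree_le (n : ℕ) (a : ℝ) : (laguerrePoly n a).natDegree ≤ n :=
  (Polynomial.natDegree_C_mul_le _ _).trans (kummer_natDegree_le n a)

theorem sum_front_add_last {k : ℕ} (n : Fin (k + 1) → ℕ) :
    ∑ j, front n j + n (Fin.last k) = ∑ i, n i := (Fin.sum_univ_castSucc n).symm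

theorem totalDegree_laguerreStarPoly_le {k : ℕ} (α : Fin (k + 1) → ℝ) (n : Fin (k + 1) → ℕ) :
    (laguerreStarPoly α n).totalDegree ≤ ∑ i, n i := by
  refine (MvPolynomial.totalDegree_mul _ _).trans ?_
  have h1 := isHomogeneous_jacobiPoly α (front n) |>.totalDegree_le
  have hS : (∑ i : Fin (k + 1), (MvPolynomial.X i : MvPolynomial (Fin (k + 1)) ℝ)).IsHomogeneous 1 :=
    MvPolynomial.IsHomogeneous.sum _ _ _ fun i _ => MvPolynomial.isHomogeneous_X _ i
  have h2 := (totalDegree_aeval_le (laguerrePoly (n (Fin.last k))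
    ((∑ i, α i) + 2 * ((∑ j, front n j : ℕ) : ℝ))) hS.totalDegree_le).trans
      (laguerrePoly_natDegree_le _ _)
  have := sum_front_add_last n
  omega

theorem totalDegree_laguerreProdPoly_le {k : ℕ} (α : Fin (k + 1) → ℝ) (m : Fin (k + 1) → ℕ) :
    (laguerreProdPoly α m).totalDegree ≤ ∑ i, m i := by
  refine (MvPolynomial.totalDegree_finsetProd _ _).trans (Finset.sum_le_sum fun i _ => ?_)
  exact (totalDegree_aeval_le _ (MvPolynomial.totalDegree_X i).le).trans
    (laguerrePoly_natDegree_le _ _)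

/-- A functional vanishing on the products with low-degree monomials vanishes on the products with
low-degree polynomials. -/
theorem gammaFunctionalMv_mul_eq_zero {d M : ℕ} {α : Fin d → ℝ} {F : MvPolynomial (Fin d) ℝ}
    (hF : ∀ p : Fin d → ℕ, ∑ i, p i < M →
      gammaFunctionalMv α (F * ∏ i, MvPolynomial.X i ^ p i) = 0)
    {P : MvPolynomial (Fin d) ℝ} (hP : P.totalDegree < M) : gammaFunctionalMv α (F * P) = 0 := by
  rw [P.as_sum, Finset.mul_sum, map_sum]
  refine Finset.sum_eq_zero fun p hp => ?_
  rw [MvPolynomial.monomial_eq, mul_left_comm, gammaFunctionalMv_C_mul,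
    Finsupp.prod_fintype _ _ fun i => pow_zero _, hF, mul_zero]
  have := MvPolynomial.le_totalDegree hp
  rw [Finsupp.sum_fintype _ _ fun _ => rfl] at this
  omega

theorem gammaFunctionalMv_prod_aeval_X {d : ℕ} (α : Fin d → ℝ) (f : Fin d → Polynomial ℝ) :
    gammaFunctionalMv α (∏ i, Polynomial.aeval (MvPolynomial.X i) (f i)) =
      ∏ i, gammaFunctional (α i) (f i) := by
  have h1 : ∀ i, Polynomial.aeval (MvPolynomial.X i : MvPolynomial (Fin d) ℝ) (f i) =
      ∑ l ∈ Finset.range ((f i).natDegree + 1),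
        MvPolynomial.C ((f i).coeff l) * MvPolynomial.X i ^ l := fun i => by
    rw [Polynomial.aeval_eq_sum_range]
    exact Finset.sum_congr rfl fun l _ => (MvPolynomial.C_mul' ..).symm
  have h2 : ∀ i, gammaFunctional (α i) (f i) =
      ∑ l ∈ Finset.range ((f i).natDegree + 1), (f i).coeff l * rising (α i) l := fun i => by
    conv_lhs => rw [(f i).as_sum_range_C_mul_X_pow, map_sum]
    exact Finset.sum_congr rfl fun l _ => by rw [gammaFunctional_C_mul, gammaFunctional_X_pow]
  simp only [h1, h2]
  rw [Finset.prod_univ_sum, Finset.prod_univ_sum, map_sum]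
  refine Finset.sum_congr rfl fun p _ => ?_
  have h3 : ∏ i, (MvPolynomial.X i : MvPolynomial (Fin d) ℝ) ^ p i =
      MvPolynomial.monomial (Finsupp.equivFunOnFinite.symm p) 1 := by
    rw [MvPolynomial.monomial_eq, map_one, one_mul, Finsupp.prod_fintype _ _ fun i => pow_zero _]
    rfl
  rw [Finset.prod_mul_distrib, ← map_prod, gammaFunctionalMv_C_mul, h3, gammaFunctionalMv_monomial,
    one_mul, Finset.prod_mul_distrib]
  rfl

/-- Some coordinate has `p i < m i`, and its factor in the product of one-variable functionals
vanishes. -/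
theorem gammaFunctionalMv_laguerreProdPoly_mul_eq_zero {k : ℕ} {α : Fin (k + 1) → ℝ}
    (hα : ∀ i, 0 < α i) (m p : Fin (k + 1) → ℕ) (h : ∑ i, p i < ∑ i, m i) :
    gammaFunctionalMv α (laguerreProdPoly α m * ∏ i, MvPolynomial.X i ^ p i) = 0 := by
  obtain ⟨i, -, hi⟩ := Finset.exists_lt_of_sum_lt h
  have : laguerreProdPoly α m * ∏ i, MvPolynomial.X i ^ p i =
      ∏ i, Polynomial.aeval (MvPolynomial.X i) (laguerrePoly (m i) (α i) * Polynomial.X ^ p i) := by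
    rw [laguerreProdPoly, ← Finset.prod_mul_distrib]
    simp
  rw [this, gammaFunctionalMv_prod_aeval_X, Finset.prod_eq_zero (Finset.mem_univ i)]
  rw [laguerrePoly, mul_assoc, gammaFunctional_C_mul,
    gammaFunctional_kummer_mul_eq_zero (hα i) (by simpa using hi), mul_zero]

/-- Powers of the total sum come out by homogeneity. If `|p| < N` the Jacobi factor gives zero;
otherwise `|p| = N + r` with `r < nd`, and the radial Laguerre factor does. -/
theorem gammaFunctionalMv_laguerreStarPoly_mul_eq_zero {k : ℕ} {α : Fin (k + 1) → ℝ}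
    (hα : ∀ i, 0 < α i) (n p : Fin (k + 1) → ℕ) (h : ∑ i, p i < ∑ i, n i) :
    gammaFunctionalMv α (laguerreStarPoly α n * ∏ i, MvPolynomial.X i ^ p i) = 0 := by
  set N := ∑ j, front n j with hN
  set nd := n (Fin.last k)
  have hsum : N + nd = ∑ i, n i := sum_front_add_last n
  set F := jacobiPoly α (front n) * ∏ i, MvPolynomial.X i ^ p i with hF
  have hFh : F.IsHomogeneous (N + ∑ i, p i) :=
    (isHomogeneous_jacobiPoly _ _).mul (isHomogeneous_prod_X_pow _)
  have ha : 0 < ∑ i, α i := Finset.sum_pos (fun i _ => hα i) (by simp)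
  rw [laguerreStarPoly, mul_assoc, ← hF, laguerrePoly, map_mul (Polynomial.aeval _),
    Polynomial.aeval_C, mul_assoc, MvPolynomial.algebraMap_eq, gammaFunctionalMv_C_mul]
  by_cases hlt : ∑ i, p i < N
  · rw [kummer, map_sum, Finset.sum_mul, map_sum]
    refine mul_eq_zero_of_right _ (Finset.sum_eq_zero fun q _ => ?_)
    rw [map_mul (Polynomial.aeval _), Polynomial.aeval_C, map_pow, Polynomial.aeval_X, mul_assoc,
      MvPolynomial.algebraMap_eq, gammaFunctionalMv_C_mul, gammaFunctionalMv_sum_X_pow_mul α hFh,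
      hF, gammaFunctionalMv_jacobiPoly_mul_eq_zero hα _ _ hlt, mul_zero, mul_zero]
  · obtain ⟨r, hr⟩ := Nat.exists_eq_add_of_le (not_lt.1 hlt)
    have hb : 0 < ∑ i, α i + 2 * (N : ℝ) := by positivity
    have hz := gammaFunctional_kummer_mul_eq_zero hb (n := nd) (P := Polynomial.X ^ r)
      (by simp; omega)
    -- The factor `rising (|α| + 2N) r` completes `rising (|α| + 2N + r) q` to a moment of the Gamma
    -- law of shape `|α| + 2N`.
    have : gammaFunctionalMv α (Polynomial.aeval (∑ i, MvPolynomial.X i)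
        (kummer nd (∑ i, α i + 2 * (N : ℝ))) * F) * rising (∑ i, α i + 2 * (N : ℝ)) r =
        gammaFunctional (∑ i, α i + 2 * (N : ℝ))
          (kummer nd (∑ i, α i + 2 * (N : ℝ)) * Polynomial.X ^ r) * gammaFunctionalMv α F := by
      rw [kummer, map_sum, Finset.sum_mul, map_sum, Finset.sum_mul, Finset.sum_mul,
        map_sum (gammaFunctional _), Finset.sum_mul]
      refine Finset.sum_congr rfl fun q _ => ?_
      rw [map_mul (Polynomial.aeval _), Polynomial.aeval_C, map_pow, Polynomial.aeval_X, mul_assoc,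
        MvPolynomial.algebraMap_eq, gammaFunctionalMv_C_mul, gammaFunctionalMv_sum_X_pow_mul α hFh,
        mul_assoc (Polynomial.C _), ← pow_add, gammaFunctional_C_mul, gammaFunctional_X_pow,
        add_comm q r, rising_add, hr,
        show ∑ i, α i + ((N + (N + r) : ℕ) : ℝ) = ∑ i, α i + 2 * (N : ℝ) + r by push_cast; ring]
      ring
    rw [hz, zero_mul] at this
    rw [(mul_eq_zero.1 this).resolve_right (rising_pos hb r).ne', mul_zero]

theorem gammaFunctionalMv_laguerreStar_mul_laguerreProd_eq_zero {k : ℕ} {α : Fin (k + 1) → ℝ}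
    (hα : ∀ i, 0 < α i) (m n : Fin (k + 1) → ℕ) (h : ∑ i, m i ≠ ∑ i, n i) :
    gammaFunctionalMv α (laguerreStarPoly α n * laguerreProdPoly α m) = 0 := by
  rcases lt_or_gt_of_ne h with h | h
  · exact gammaFunctionalMv_mul_eq_zero (gammaFunctionalMv_laguerreStarPoly_mul_eq_zero hα n)
      ((totalDegree_laguerreProdPoly_le α m).trans_lt h)
  · rw [mul_comm]
    exact gammaFunctionalMv_mul_eq_zero (gammaFunctionalMv_laguerreProdPoly_mul_eq_zero hα m)
      ((totalDegree_laguerreStarPoly_le α n).trans_lt h)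

/-! ### Moments of Gamma laws -/

theorem Real.Gamma_add_natCast {a : ℝ} (ha : 0 < a) (n : ℕ) :
    Real.Gamma (a + n) = rising a n * Real.Gamma a := by
  induction n with
  | zero => simp [rising_zero]
  | succ n ih =>
    rw [Nat.cast_succ, ← add_assoc, Real.Gamma_add_one (by positivity), ih, rising_succ]
    ring

theorem Real.rpow_sub_one_mul_pow {a x : ℝ} (ha : 0 < a) (hx : 0 ≤ x) (p : ℕ) :
    x ^ (a - 1) * x ^ p = x ^ (a + p - 1) := by
  rcases hx.eq_or_lt with rfl | hx
  · rcases p.eq_zero_or_pos with rfl | hp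
    · simp
    -- At `x = 0` the exponent `a + p - 1` is nonzero, so the convention `0 ^ 0 = 1` does not
    -- interfere.
    · have : (1 : ℝ) ≤ p := by exact_mod_cast hp
      rw [zero_pow hp.ne', Real.zero_rpow (x := a + p - 1) (by linarith), mul_zero]
  · rw [← Real.rpow_add_natCast hx.ne']
    ring_nf

theorem integrable_gammaPDFReal {a : ℝ} (ha : 0 < a) : Integrable (gammaPDFReal a 1) := by
  rw [← lintegral_ofReal_ne_top_iff_integrable
    (measurable_gammaPDFReal a 1).aestronglyMeasurable
    (Filter.Eventually.of_forall (gammaPDFReal_nonneg ha one_pos))]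
  exact (lintegral_gammaPDF_eq_one ha one_pos).trans_ne ENNReal.one_ne_top

theorem integral_gammaPDFReal {a : ℝ} (ha : 0 < a) : ∫ x, gammaPDFReal a 1 x = 1 := by
  rw [integral_eq_lintegral_of_nonneg_ae
    (Filter.Eventually.of_forall (gammaPDFReal_nonneg ha one_pos))
    (measurable_gammaPDFReal a 1).aestronglyMeasurable]
  exact (ENNReal.toReal_eq_one_iff _).2 (lintegral_gammaPDF_eq_one ha one_pos)

theorem gammaPDF_toReal_smul_pow {a : ℝ} (ha : 0 < a) (p : ℕ) (x : ℝ) :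
    (gammaPDF a 1 x).toReal • x ^ p = rising a p * gammaPDFReal (a + p) 1 x := by
  rw [gammaPDF, ENNReal.toReal_ofReal (gammaPDFReal_nonneg ha one_pos x), gammaPDFReal,
    gammaPDFReal, smul_eq_mul]
  split_ifs with hx
  · rw [← Real.rpow_sub_one_mul_pow ha hx, Real.Gamma_add_natCast ha]
    have h1 := (Real.Gamma_pos_of_pos ha).ne'
    have h2 := (rising_pos ha p).ne'
    simp only [Real.one_rpow]
    field_simp
  · simp

theorem integrable_pow_gammaMeasure {a : ℝ} (ha : 0 < a) (p : ℕ) :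
    Integrable (fun x => x ^ p) (gammaMeasure a 1) := by
  rw [gammaMeasure, integrable_withDensity_iff_integrable_smul' (f := gammaPDF a 1)
    (measurable_gammaPDFReal a 1).ennreal_ofReal
    (Filter.Eventually.of_forall fun _ => ENNReal.ofReal_lt_top)]
  simp only [gammaPDF_toReal_smul_pow ha]
  exact (integrable_gammaPDFReal (by positivity)).const_mul _

theorem integral_pow_gammaMeasure {a : ℝ} (ha : 0 < a) (p : ℕ) :
    ∫ x, x ^ p ∂(gammaMeasure a 1) = rising a p := by
  rw [gammaMeasure, integral_withDensity_eq_integral_toReal_smul (f := gammaPDF a 1)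
    (measurable_gammaPDFReal a 1).ennreal_ofReal
    (Filter.Eventually.of_forall fun _ => ENNReal.ofReal_lt_top)]
  simp only [gammaPDF_toReal_smul_pow ha]
  rw [integral_const_mul, integral_gammaPDFReal (by positivity), mul_one]

theorem gammaMeasure_ae_pos (a : ℝ) : ∀ᵐ x ∂(gammaMeasure a 1), 0 < x := by
  rw [gammaMeasure, ae_withDensity_iff (f := gammaPDF a 1)
    (measurable_gammaPDFReal a 1).ennreal_ofReal]
  filter_upwards [Measure.ae_ne volume (0 : ℝ)] with x hx h
  by_contra hlt
  exact h (gammaPDF_of_neg (lt_of_le_of_ne (not_lt.1 hlt) hx))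

theorem integrable_integral_eval_gammaProd {k : ℕ} {α : Fin (k + 1) → ℝ} (hα : ∀ i, 0 < α i)
    (P : MvPolynomial (Fin (k + 1)) ℝ) :
    Integrable (fun y => MvPolynomial.eval y P) (gammaProd α) ∧
      ∫ y, MvPolynomial.eval y P ∂(gammaProd α) = gammaFunctionalMv α P := by
  have : ∀ i, IsProbabilityMeasure (gammaMeasure (α i) 1) := fun i =>
    isProbabilityMeasure_gammaMeasure (hα i) one_pos
  induction P using MvPolynomial.induction_on' with
  | monomial p c =>
    simp only [MvPolynomial.eval_monomial, Finsupp.prod_fintype _ _ fun i => pow_zero _]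
    refine ⟨(Integrable.fintype_prod fun i => integrable_pow_gammaMeasure (hα i) (p i)).const_mul c,
      ?_⟩
    rw [integral_const_mul, gammaProd, integral_fintype_prod_eq_prod fun i x => x ^ p i,
      gammaFunctionalMv_monomial]
    simp only [integral_pow_gammaMeasure (hα _)]
  | add P Q hP hQ =>
    simp only [map_add]
    exact ⟨hP.1.add hQ.1, by rw [integral_add hP.1 hQ.1, hP.2, hQ.2]⟩

theorem gammaProd_ae_pos {k : ℕ} {α : Fin (k + 1) → ℝ} (hα : ∀ i, 0 < α i) :
    ∀ᵐ y ∂(gammaProd α), ∀ i, 0 < y i := by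
  have : ∀ i, IsProbabilityMeasure (gammaMeasure (α i) 1) := fun i =>
    isProbabilityMeasure_gammaMeasure (hα i) one_pos
  exact ae_all_iff.2 fun i => Measure.tendsto_eval_ae_ae.eventually (gammaMeasure_ae_pos (α i))

/-! ### Normalization and moments of the Dirichlet law -/

theorem lintegral_Ioo_rpow_mul_rpow {a b w : ℝ} (ha : 0 < a) (hb : 0 < b) (hw : 0 < w) :
    ∫⁻ x in Set.Ioo 0 w, ENNReal.ofReal (x ^ (a - 1) * (w - x) ^ (b - 1)) =
      ENNReal.ofReal (w ^ (a + b - 1) * beta a b) := by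
  have h1 : ∫⁻ x in Set.Ioo (0 : ℝ) 1, ENNReal.ofReal (x ^ (a - 1) * (1 - x) ^ (b - 1)) =
      ENNReal.ofReal (beta a b) := by
    have h := lintegral_betaPDF_eq_one ha hb
    have hB := beta_pos ha hb
    rw [lintegral_betaPDF] at h
    calc _ = ∫⁻ x in Set.Ioo (0 : ℝ) 1, ENNReal.ofReal (beta a b) *
          ENNReal.ofReal (1 / beta a b * x ^ (a - 1) * (1 - x) ^ (b - 1)) := by
          refine lintegral_congr fun x => ?_
          rw [← ENNReal.ofReal_mul hB.le]
          congr 1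
          field_simp
      _ = _ := by
          rw [lintegral_const_mul' _ _ ENNReal.ofReal_ne_top, h, mul_one]
  have himg : Set.Ioo 0 w = (fun x => w * x) '' Set.Ioo 0 1 := by
    rw [Set.image_mul_left_Ioo hw]
    simp
  rw [himg, lintegral_image_eq_lintegral_abs_deriv_mul measurableSet_Ioo (f' := fun _ => w)
    (fun x _ => by simpa using ((hasDerivAt_id x).const_mul w).hasDerivWithinAt)
    (fun x _ y _ h => mul_left_cancel₀ hw.ne' h), ENNReal.ofReal_mul (by positivity), ← h1,
    ← lintegral_const_mul' _ _ ENNReal.ofReal_ne_top]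
  refine setLIntegral_congr_fun measurableSet_Ioo fun x hx => ?_
  have hx1 : 0 ≤ 1 - x := by linarith [hx.2]
  rw [← ENNReal.ofReal_mul (by positivity), ← ENNReal.ofReal_mul (by positivity), abs_of_pos hw,
    show w - w * x = w * (1 - x) by ring, Real.mul_rpow hw.le hx.1.le, Real.mul_rpow hw.le hx1,
    show a + b - 1 = 1 + (a - 1) + (b - 1) by ring, Real.rpow_add hw, Real.rpow_add hw,
    Real.rpow_one]
  congr 1
  ring

open Classical in
/-- The unnormalized Dirichlet density on the simplex of size `w`. -/
noncomputable def dirichletKernel {k : ℕ} (α : Fin (k + 1) → ℝ) (w : ℝ) (x : Fin k → ℝ) : ENNReal :=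
  if (∀ i, 0 ≤ x i) ∧ ∑ i, x i ≤ w then
    ENNReal.ofReal ((∏ i, x i ^ (α i.castSucc - 1)) * (w - ∑ i, x i) ^ (α (Fin.last k) - 1))
  else 0

theorem measurable_dirichletKernel {k : ℕ} (α : Fin (k + 1) → ℝ) (w : ℝ) :
    Measurable (dirichletKernel α w) := by
  refine Measurable.ite ?_ (by fun_prop) measurable_const
  refine MeasurableSet.inter (s₁ := {x : Fin k → ℝ | ∀ i, 0 ≤ x i})
    (s₂ := {x : Fin k → ℝ | ∑ i, x i ≤ w}) ?_
    (measurableSet_le (by fun_prop) measurable_const)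
  simp only [Set.ofPred_forall]
  exact MeasurableSet.iInter fun i => measurableSet_le measurable_const (measurable_pi_apply i)

/-- Fixing the first coordinate leaves a simplex of size `w - s`, which is why the kernel carries a
size. -/
theorem dirichletKernel_cons {k : ℕ} (α : Fin (k + 2) → ℝ) (w s : ℝ) (x : Fin k → ℝ) :
    dirichletKernel α w (Fin.cons s x : Fin (k + 1) → ℝ) =
      (Set.Icc 0 w).indicator (fun s => ENNReal.ofReal (s ^ (α 0 - 1))) s *
        dirichletKernel (fun i => α i.succ) (w - s) x := by
  simp only [dirichletKernel, Fin.forall_fin_succ, Fin.sum_univ_succ, Fin.prod_univ_succ,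
    Fin.cons_zero, Fin.cons_succ, Fin.castSucc_zero, Fin.succ_castSucc, Fin.succ_last]
  by_cases hx : (∀ i, 0 ≤ x i) ∧ ∑ i, x i ≤ w - s
  · have hsum : 0 ≤ ∑ i, x i := Finset.sum_nonneg fun i _ => hx.1 i
    by_cases hs : 0 ≤ s
    · have hc : (0 ≤ s ∧ ∀ i, 0 ≤ x i) ∧ s + ∑ i, x i ≤ w := ⟨⟨hs, hx.1⟩, by linarith [hx.2]⟩
      rw [if_pos hc, if_pos hx,
        Set.indicator_of_mem (show s ∈ Set.Icc 0 w from ⟨hs, by linarith [hx.2]⟩),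
        ← ENNReal.ofReal_mul (Real.rpow_nonneg hs _), sub_sub, mul_assoc]
    · rw [if_neg (fun h : (0 ≤ s ∧ ∀ i, 0 ≤ x i) ∧ s + ∑ i, x i ≤ w => hs h.1.1),
        Set.indicator_of_notMem (fun h : s ∈ Set.Icc 0 w => hs h.1), zero_mul]
  · rw [if_neg (fun h : (0 ≤ s ∧ ∀ i, 0 ≤ x i) ∧ s + ∑ i, x i ≤ w => hx ⟨h.1.2, by linarith [h.2]⟩),
      if_neg hx, mul_zero]

theorem lintegral_dirichletKernel {k : ℕ} {α : Fin (k + 1) → ℝ} (hα : ∀ i, 0 < α i) {w : ℝ}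
    (hw : 0 < w) :
    ∫⁻ x, dirichletKernel α w x =
      ENNReal.ofReal (w ^ (∑ i, α i - 1) * ((∏ i, Real.Gamma (α i)) / Real.Gamma (∑ i, α i))) := by
  induction k generalizing w with
  | zero =>
    have h := (Real.Gamma_pos_of_pos (hα 0)).ne'
    simp [dirichletKernel, hw.le, h, volume_pi]
  | succ k ih =>
    have hA : 0 < ∑ i : Fin (k + 1), α i.succ := Finset.sum_pos (fun i _ => hα i.succ) (by simp)
    have hmp := (volume_preserving_piFinSuccAbove (fun _ : Fin (k + 1) => ℝ) 0).symm
    rw [← hmp.lintegral_comp_emb (MeasurableEquiv.measurableEmbedding _), Measure.volume_eq_prod,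
      lintegral_prod (fun z : ℝ × (Fin k → ℝ) => dirichletKernel α w
        ((MeasurableEquiv.piFinSuccAbove (fun _ : Fin (k + 1) => ℝ) 0).symm z))
        ((measurable_dirichletKernel α w).comp (MeasurableEquiv.measurable _)).aemeasurable]
    set C := (∏ i : Fin (k + 1), Real.Gamma (α i.succ)) / Real.Gamma (∑ i : Fin (k + 1), α i.succ)
      with hC
    have hCpos : 0 < C := div_pos (Finset.prod_pos fun i _ => Real.Gamma_pos_of_pos (hα i.succ))
      (Real.Gamma_pos_of_pos hA)
    have hcons : ∀ (s : ℝ) (x : Fin k → ℝ),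
        (MeasurableEquiv.piFinSuccAbove (fun _ : Fin (k + 1) => ℝ) 0).symm (s, x) =
          (Fin.cons s x : Fin (k + 1) → ℝ) := fun s x => by
      simp [MeasurableEquiv.piFinSuccAbove_symm_apply, Fin.insertNthEquiv]
    simp only [hcons, dirichletKernel_cons]
    have hinner : ∀ s, ∫⁻ x, (Set.Icc 0 w).indicator
          (fun s => ENNReal.ofReal (s ^ (α 0 - 1))) s * dirichletKernel (fun i => α i.succ) (w - s) x =
        (Set.Icc 0 w).indicator (fun s => ENNReal.ofReal (s ^ (α 0 - 1)) *
          ∫⁻ x, dirichletKernel (fun i => α i.succ) (w - s) x) s := by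
      intro s
      rw [lintegral_const_mul _ (measurable_dirichletKernel _ _)]
      by_cases hs : s ∈ Set.Icc 0 w
      · simp only [Set.indicator_of_mem hs]
      · simp only [Set.indicator_of_notMem hs, zero_mul]
    simp only [hinner]
    -- Dropping the endpoints ensures `0 < w - s`, as the induction hypothesis requires; a Beta
    -- integral in `s` remains.
    rw [lintegral_indicator measurableSet_Icc, setLIntegral_congr Ioo_ae_eq_Icc.symm]
    have hstep : ∀ s ∈ Set.Ioo 0 w, ENNReal.ofReal (s ^ (α 0 - 1)) *
        ∫⁻ x, dirichletKernel (fun i => α i.succ) (w - s) x =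
        ENNReal.ofReal C * ENNReal.ofReal
          (s ^ (α 0 - 1) * (w - s) ^ (∑ i : Fin (k + 1), α i.succ - 1)) := by
      intro s hs
      have hs0 := hs.1
      have hws : 0 < w - s := by linarith [hs.2]
      rw [ih (α := fun i => α i.succ) (fun i => hα i.succ) hws, ← ENNReal.ofReal_mul (by positivity),
        ← ENNReal.ofReal_mul hCpos.le, ← hC]
      congr 1
      ring
    rw [setLIntegral_congr_fun measurableSet_Ioo hstep,
      lintegral_const_mul' _ _ ENNReal.ofReal_ne_top, lintegral_Ioo_rpow_mul_rpow (hα 0) hA hw,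
      ← ENNReal.ofReal_mul hCpos.le, Fin.sum_univ_succ α, Fin.prod_univ_succ, hC, beta]
    congr 1
    have := (Real.Gamma_pos_of_pos hA).ne'
    field_simp

/-- The barycentric coordinates of a point of the simplex. -/
def barycentric {k : ℕ} (t : Fin k → ℝ) : Fin (k + 1) → ℝ :=
  Fin.snoc (α := fun _ => ℝ) t (1 - ∑ i, t i)

theorem barycentric_castSucc {k : ℕ} (t : Fin k → ℝ) (i : Fin k) :
    barycentric t i.castSucc = t i := by simp [barycentric]

theorem barycentric_last {k : ℕ} (t : Fin k → ℝ) :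
    barycentric t (Fin.last k) = 1 - ∑ i, t i := by simp [barycentric]

theorem sum_barycentric {k : ℕ} (t : Fin k → ℝ) : ∑ i, barycentric t i = 1 := by
  simp [Fin.sum_univ_castSucc, barycentric_castSucc, barycentric_last]

theorem barycentric_nonneg {k : ℕ} {t : Fin k → ℝ} (ht : t ∈ simplex k) (i : Fin (k + 1)) :
    0 ≤ barycentric t i := by
  induction i using Fin.lastCases with
  | last => rw [barycentric_last]; linarith [ht.2]
  | cast i => rw [barycentric_castSucc]; exact ht.1 i

theorem measurableSet_simplex (k : ℕ) : MeasurableSet (simplex k) := by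
  refine MeasurableSet.inter (s₁ := {x : Fin k → ℝ | ∀ i, 0 ≤ x i})
    (s₂ := {x : Fin k → ℝ | ∑ i, x i ≤ 1}) ?_
    (measurableSet_le (by fun_prop) measurable_const)
  simp only [Set.ofPred_forall]
  exact MeasurableSet.iInter fun i => measurableSet_le measurable_const (measurable_pi_apply i)

theorem measurable_dirichletDensity {k : ℕ} (α : Fin (k + 1) → ℝ) :
    Measurable (dirichletDensity α) := by
  unfold dirichletDensity
  fun_prop

theorem dirichletDensity_eq {k : ℕ} (α : Fin (k + 1) → ℝ) (t : Fin k → ℝ) :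
    dirichletDensity α t = Real.Gamma (∑ i, α i) / (∏ i, Real.Gamma (α i)) *
      ∏ i, barycentric t i ^ (α i - 1) := by
  simp only [dirichletDensity, Fin.prod_univ_castSucc (fun i => barycentric t i ^ (α i - 1)),
    barycentric_castSucc, barycentric_last, mul_assoc]

theorem dirichletDensity_nonneg {k : ℕ} {α : Fin (k + 1) → ℝ} (hα : ∀ i, 0 < α i) {t : Fin k → ℝ}
    (ht : t ∈ simplex k) : 0 ≤ dirichletDensity α t := by
  rw [dirichletDensity_eq]
  have ha : 0 < ∑ i, α i := Finset.sum_pos (fun i _ => hα i) (by simp)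
  exact mul_nonneg (div_nonneg (Real.Gamma_pos_of_pos ha).le
    (Finset.prod_nonneg fun i _ => (Real.Gamma_pos_of_pos (hα i)).le))
    (Finset.prod_nonneg fun i _ => Real.rpow_nonneg (barycentric_nonneg ht i) _)

theorem dirichletKernel_of_mem {k : ℕ} {α : Fin (k + 1) → ℝ} {t : Fin k → ℝ} (ht : t ∈ simplex k) :
    dirichletKernel α 1 t = ENNReal.ofReal
      ((∏ i, t i ^ (α i.castSucc - 1)) * (1 - ∑ i, t i) ^ (α (Fin.last k) - 1)) :=
  if_pos ht

theorem dirichletKernel_of_notMem {k : ℕ} {α : Fin (k + 1) → ℝ} {t : Fin k → ℝ}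
    (ht : t ∉ simplex k) : dirichletKernel α 1 t = 0 :=
  if_neg ht

theorem lintegral_dirichletDensity {k : ℕ} {α : Fin (k + 1) → ℝ} (hα : ∀ i, 0 < α i) :
    ∫⁻ t in simplex k, ENNReal.ofReal (dirichletDensity α t) = 1 := by
  have ha : 0 < Real.Gamma (∑ i, α i) :=
    Real.Gamma_pos_of_pos (Finset.sum_pos (fun i _ => hα i) (by simp))
  have hp : 0 < ∏ i, Real.Gamma (α i) := Finset.prod_pos fun i _ => Real.Gamma_pos_of_pos (hα i)
  rw [← lintegral_indicator (measurableSet_simplex k)]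
  have : ∀ t, (simplex k).indicator (fun t => ENNReal.ofReal (dirichletDensity α t)) t =
      ENNReal.ofReal (Real.Gamma (∑ i, α i) / ∏ i, Real.Gamma (α i)) * dirichletKernel α 1 t := by
    intro t
    by_cases ht : t ∈ simplex k
    · rw [Set.indicator_of_mem ht, dirichletKernel_of_mem ht, ← ENNReal.ofReal_mul (by positivity),
        dirichletDensity, mul_assoc]
    · rw [Set.indicator_of_notMem ht, dirichletKernel_of_notMem ht, mul_zero]
  simp only [this]
  rw [lintegral_const_mul' _ _ ENNReal.ofReal_ne_top, lintegral_dirichletKernel hα one_pos,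
    ← ENNReal.ofReal_mul (by positivity), Real.one_rpow, one_mul, div_mul_div_comm,
    mul_comm (∏ i, Real.Gamma (α i)), div_self (by positivity), ENNReal.ofReal_one]

theorem integrableOn_dirichletDensity {k : ℕ} {α : Fin (k + 1) → ℝ} (hα : ∀ i, 0 < α i) :
    IntegrableOn (dirichletDensity α) (simplex k) := by
  rw [IntegrableOn, ← lintegral_ofReal_ne_top_iff_integrable
    (measurable_dirichletDensity α).aestronglyMeasurable
    (ae_restrict_of_forall_mem (measurableSet_simplex k) fun t ht => dirichletDensity_nonneg hα ht),
    lintegral_dirichletDensity hα]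
  exact ENNReal.one_ne_top

theorem integral_dirichletDensity {k : ℕ} {α : Fin (k + 1) → ℝ} (hα : ∀ i, 0 < α i) :
    ∫ t in simplex k, dirichletDensity α t = 1 := by
  rw [integral_eq_lintegral_of_nonneg_ae
    (ae_restrict_of_forall_mem (measurableSet_simplex k) fun t ht => dirichletDensity_nonneg hα ht)
    (measurable_dirichletDensity α).aestronglyMeasurable, lintegral_dirichletDensity hα,
    ENNReal.toReal_one]

/-- A monomial only shifts the parameters to `α + p`, so moments are ratios of normalizing
constants. -/
theorem dirichletDensity_smul_prod_pow {k : ℕ} {α : Fin (k + 1) → ℝ} (hα : ∀ i, 0 < α i)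
    (p : Fin (k + 1) → ℕ) {t : Fin k → ℝ} (ht : t ∈ simplex k) :
    (ENNReal.ofReal (dirichletDensity α t)).toReal • ∏ i, barycentric t i ^ p i =
      (∏ i, rising (α i) (p i)) / rising (∑ i, α i) (∑ i, p i) *
        dirichletDensity (fun i => α i + p i) t := by
  have ha : 0 < ∑ i, α i := Finset.sum_pos (fun i _ => hα i) (by simp)
  rw [ENNReal.toReal_ofReal (dirichletDensity_nonneg hα ht), dirichletDensity_eq,
    dirichletDensity_eq, smul_eq_mul, mul_assoc, ← Finset.prod_mul_distrib, Finset.sum_add_distrib,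
    ← Nat.cast_sum, Real.Gamma_add_natCast ha]
  simp only [Real.rpow_sub_one_mul_pow (hα _) (barycentric_nonneg ht _),
    Real.Gamma_add_natCast (hα _), Finset.prod_mul_distrib]
  have h1 := (Real.Gamma_pos_of_pos ha).ne'
  have h2 : ∏ i, Real.Gamma (α i) ≠ 0 :=
    (Finset.prod_pos fun i _ => Real.Gamma_pos_of_pos (hα i)).ne'
  have h3 : ∏ i, rising (α i) (p i) ≠ 0 := (Finset.prod_pos fun i _ => rising_pos (hα i) _).ne'
  have h4 := (rising_pos ha (∑ i, p i)).ne'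
  field_simp

theorem integrable_integral_prod_pow_dirichlet {k : ℕ} {α : Fin (k + 1) → ℝ} (hα : ∀ i, 0 < α i)
    (p : Fin (k + 1) → ℕ) :
    Integrable (fun t => ∏ i, barycentric t i ^ p i) (dirichlet α) ∧
      ∫ t, ∏ i, barycentric t i ^ p i ∂(dirichlet α) =
        (∏ i, rising (α i) (p i)) / rising (∑ i, α i) (∑ i, p i) := by
  have hαp : ∀ i, 0 < α i + p i := fun i => add_pos_of_pos_of_nonneg (hα i) (Nat.cast_nonneg _)
  have hmeas := (measurable_dirichletDensity α).ennreal_ofReal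
  have hfin : ∀ᵐ t ∂(volume.restrict (simplex k)), ENNReal.ofReal (dirichletDensity α t) < ⊤ :=
    Filter.Eventually.of_forall fun _ => ENNReal.ofReal_lt_top
  have hcongr : (fun t => (ENNReal.ofReal (dirichletDensity α t)).toReal •
      ∏ i, barycentric t i ^ p i) =ᵐ[volume.restrict (simplex k)]
      fun t => (∏ i, rising (α i) (p i)) / rising (∑ i, α i) (∑ i, p i) *
        dirichletDensity (fun i => α i + p i) t :=
    ae_restrict_of_forall_mem (measurableSet_simplex k) fun t ht =>
      dirichletDensity_smul_prod_pow hα p ht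
  constructor
  · rw [dirichlet, integrable_withDensity_iff_integrable_smul' hmeas hfin, integrable_congr hcongr]
    exact Integrable.const_mul (integrableOn_dirichletDensity hαp) _
  · rw [dirichlet, integral_withDensity_eq_integral_toReal_smul hmeas hfin, integral_congr_ae hcongr,
      integral_const_mul, integral_dirichletDensity hαp, mul_one]

theorem integrable_eval_barycentric {k : ℕ} {α : Fin (k + 1) → ℝ} (hα : ∀ i, 0 < α i)
    (P : MvPolynomial (Fin (k + 1)) ℝ) :
    Integrable (fun t => MvPolynomial.eval (barycentric t) P) (dirichlet α) := by
  induction P using MvPolynomial.induction_on' with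
  | monomial p c =>
    simp only [MvPolynomial.eval_monomial, Finsupp.prod_fintype _ _ fun i => pow_zero _]
    exact (integrable_integral_prod_pow_dirichlet hα p).1.const_mul c
  | add P Q hP hQ =>
    simp only [map_add]
    exact hP.add hQ

/-! ### Polar decomposition -/

/-- The restriction of `P` to the line spanned by `x`, as a polynomial in one variable. -/
noncomputable def alongRay {d : ℕ} (x : Fin d → ℝ) :
    MvPolynomial (Fin d) ℝ →ₐ[ℝ] Polynomial ℝ :=
  MvPolynomial.aeval fun i => Polynomial.C (x i) * Polynomial.X

theorem alongRay_monomial {d : ℕ} (x : Fin d → ℝ) (p : Fin d →₀ ℕ) (c : ℝ) :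
    alongRay x (MvPolynomial.monomial p c) =
      Polynomial.C (c * ∏ i, x i ^ p i) * Polynomial.X ^ (∑ i, p i) := by
  rw [alongRay, MvPolynomial.aeval_monomial, Finsupp.prod_fintype _ _ fun i => pow_zero _]
  simp only [mul_pow, Finset.prod_mul_distrib, Finset.prod_pow_eq_pow_sum, map_mul, map_prod,
    map_pow, Polynomial.algebraMap_eq, mul_assoc]

theorem eval_alongRay {d : ℕ} (x : Fin d → ℝ) (s : ℝ) (F : MvPolynomial (Fin d) ℝ) :
    (alongRay x F).eval s = MvPolynomial.eval (fun i => x i * s) F := by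
  rw [alongRay, ← Polynomial.coe_aeval_eq_eval, MvPolynomial.comp_aeval_apply,
    ← MvPolynomial.coe_aeval_eq_eval]
  simp

theorem alongRay_of_isHomogeneous {d h : ℕ} (x : Fin d → ℝ) {F : MvPolynomial (Fin d) ℝ}
    (hF : F.IsHomogeneous h) :
    alongRay x F = Polynomial.C (MvPolynomial.eval x F) * Polynomial.X ^ h := by
  rw [← F.support_sum_monomial_coeff, map_sum, map_sum, map_sum, Finset.sum_mul]
  refine Finset.sum_congr rfl fun p hp => ?_
  have hd : ∑ i, p i = h := by
    rw [← Finsupp.degree_eq_sum]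
    exact (DFunLike.congr_fun Finsupp.degree_eq_weight_one p).trans
      (hF (MvPolynomial.mem_support_iff.1 hp))
  rw [alongRay_monomial, MvPolynomial.eval_monomial, hd,
    Finsupp.prod_fintype _ _ fun i => pow_zero _]

/-- The polar decomposition of the Gamma law: the total mass has a Gamma law and is independent of
the proportions, which have a Dirichlet law. -/
theorem integrable_integral_gammaFunctional_alongRay {k : ℕ} {α : Fin (k + 1) → ℝ}
    (hα : ∀ i, 0 < α i) (P : MvPolynomial (Fin (k + 1)) ℝ) :
    Integrable (fun t => gammaFunctional (∑ i, α i) (alongRay (barycentric t) P)) (dirichlet α) ∧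
      ∫ t, gammaFunctional (∑ i, α i) (alongRay (barycentric t) P) ∂(dirichlet α) =
        gammaFunctionalMv α P := by
  have ha : 0 < ∑ i, α i := Finset.sum_pos (fun i _ => hα i) (by simp)
  induction P using MvPolynomial.induction_on' with
  | monomial p c =>
    have hp := integrable_integral_prod_pow_dirichlet hα p
    simp only [alongRay_monomial, gammaFunctional_C_mul, gammaFunctional_X_pow]
    refine ⟨(hp.1.const_mul c).mul_const _, ?_⟩
    -- The denominator of the Dirichlet moment is exactly the moment of the total mass.
    rw [integral_mul_const, integral_const_mul, hp.2, gammaFunctionalMv_monomial, mul_assoc,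
      div_mul_cancel₀ _ (rising_pos ha _).ne']
  | add P Q hP hQ =>
    simp only [map_add]
    exact ⟨hP.1.add hQ.1, by rw [integral_add hP.1 hQ.1, hP.2, hQ.2]⟩

/-- `gammaFunctional a (q * alongRay x P)` is polynomial in `x`. -/
theorem exists_eval_eq_gammaFunctional_mul_alongRay {d : ℕ} (a : ℝ) (q : Polynomial ℝ)
    (P : MvPolynomial (Fin d) ℝ) : ∃ F : MvPolynomial (Fin d) ℝ, ∀ x : Fin d → ℝ,
      gammaFunctional a (q * alongRay x P) = MvPolynomial.eval x F := by
  induction P using MvPolynomial.induction_on' with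
  | monomial p c =>
    refine ⟨MvPolynomial.monomial p (c * gammaFunctional a (q * Polynomial.X ^ (∑ i, p i))),
      fun x => ?_⟩
    rw [alongRay_monomial, mul_left_comm, gammaFunctional_C_mul, MvPolynomial.eval_monomial,
      Finsupp.prod_fintype _ _ fun i => pow_zero _]
    ring
  | add P Q hP hQ =>
    obtain ⟨F, hF⟩ := hP
    obtain ⟨G, hG⟩ := hQ
    exact ⟨F + G, fun x => by rw [map_add, mul_add, map_add, map_add, hF, hG]⟩

/-! ### The Jacobi and Laguerre systems as polynomials almost everywhere -/

/-- The last barycentric coordinate may vanish: the denominators `1 - s_{j-1}` in `jacobiMulti` are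
at least `t j`, hence nonzero. -/
theorem dirichlet_ae_pos {k : ℕ} (α : Fin (k + 1) → ℝ) :
    ∀ᵐ t ∂(dirichlet α), t ∈ simplex k ∧ ∀ i, 0 < t i := by
  refine (withDensity_absolutelyContinuous _ _).ae_le ?_
  have hne : ∀ᵐ t : Fin k → ℝ, ∀ i, t i ≠ 0 := ae_all_iff.2 fun i =>
    Measure.ae_eval_ne (α := fun _ => ℝ) (fun _ => (volume : Measure ℝ)) i (0 : ℝ)
  filter_upwards [ae_restrict_mem (measurableSet_simplex k), ae_restrict_of_ae hne] with t ht h0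
  exact ⟨ht, fun i => (ht.1 i).lt_of_ne (h0 i).symm⟩

theorem Fin.sum_Iio_add_sum_Ici_castSucc {k : ℕ} (x : Fin (k + 1) → ℝ) (j : Fin k) :
    ∑ i ∈ Finset.Iio j, x i.castSucc + ∑ i ∈ Finset.Ici j.castSucc, x i = ∑ i, x i := by
  have h : ∑ i ∈ Finset.Iio j, x i.castSucc = ∑ i ∈ Finset.Iio j.castSucc, x i := by
    rw [← Fin.map_castSuccEmb_Iio, Finset.sum_map]
    rfl
  rw [h, ← Finset.sum_union]
  · congr 1
    ext i
    simp [lt_or_ge]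
  · exact Finset.disjoint_left.2 fun i hi hi' =>
      absurd (Finset.mem_Iio.1 hi) (not_lt.2 (Finset.mem_Ici.1 hi'))

/-- As the coordinates sum to `1`, `w = 1 - s_{j-1}` is the sum over `i ≥ j`, and `w ^ n * (1 - x /
w) ^ l` equals `(w - x) ^ l * w ^ (n - l)`. -/
theorem jacobiMulti_eq_eval {k : ℕ} {α : Fin (k + 1) → ℝ} (hα : ∀ i, 0 < α i) (n : Fin k → ℕ)
    {x : Fin (k + 1) → ℝ} (hx : ∀ i, 0 ≤ x i) (hpos : ∀ i : Fin k, 0 < x i.castSucc)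
    (hsum : ∑ i, x i = 1) :
    jacobiMulti α n (fun i => x i.castSucc) = MvPolynomial.eval x (jacobiPoly α n) := by
  rw [jacobiMulti, jacobiPoly, map_prod]
  refine Finset.prod_congr rfl fun j _ => ?_
  have hb : 0 < (∑ i ∈ Finset.Ioi j.castSucc, α i) + 2 * ((∑ i ∈ Finset.Ioi j, n i : ℕ) : ℝ) := by
    refine add_pos_of_pos_of_nonneg (Finset.sum_pos (fun i _ => hα i) ?_) (by positivity)
    exact ⟨Fin.last k, Finset.mem_Ioi.2 (Fin.castSucc_lt_last j)⟩
  set w := 1 - ∑ i ∈ Finset.Iio j, x i.castSucc with hw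
  have hIci : ∑ i ∈ Finset.Ici j.castSucc, x i = w := by
    rw [hw, ← hsum, ← Fin.sum_Iio_add_sum_Ici_castSucc x j]
    ring
  have hIoi : ∑ i ∈ Finset.Ioi j.castSucc, x i = w - x j.castSucc := by
    rw [← hIci, ← Finset.Ioi_insert, Finset.sum_insert (by simp)]
    ring
  have hw0 : w ≠ 0 := by
    have h0 : 0 ≤ w - x j.castSucc := by
      rw [← hIoi]
      exact Finset.sum_nonneg fun i _ => hx i
    have := hpos j
    linarith
  rw [← MvPolynomial.coe_aeval_eq_eval, RingHom.coe_coe, map_jacobiForm, map_sum, map_sum]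
  simp only [MvPolynomial.aeval_X]
  rw [hIci, hIoi, jacobiR_eq_sum _ (hα _) hb, jacobiForm, Finset.sum_mul]
  refine Finset.sum_congr rfl fun l hl => ?_
  have hl : l ≤ n j := by simpa [Nat.lt_succ_iff] using hl
  rw [Algebra.algebraMap_self_apply, mul_assoc, one_sub_div hw0, div_pow, div_mul_eq_mul_div,
    mul_div_assoc, pow_sub₀ w hw0 hl, div_eq_mul_inv]

theorem laguerreProd_eq_eval {k : ℕ} (α : Fin (k + 1) → ℝ) (m : Fin (k + 1) → ℕ)
    (y : Fin (k + 1) → ℝ) : laguerreProd α m y = MvPolynomial.eval y (laguerreProdPoly α m) := by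
  rw [laguerreProd, laguerreProdPoly, map_prod]
  refine Finset.prod_congr rfl fun i _ => ?_
  rw [laguerre_eq_eval, ← MvPolynomial.coe_aeval_eq_eval, RingHom.coe_coe,
    ← Polynomial.aeval_algHom_apply, MvPolynomial.aeval_X, Polynomial.coe_aeval_eq_eval]

theorem laguerreStar_eq_eval {k : ℕ} {α : Fin (k + 1) → ℝ} (hα : ∀ i, 0 < α i)
    (n : Fin (k + 1) → ℕ) {y : Fin (k + 1) → ℝ} (hy : ∀ i, 0 < y i) :
    laguerreStar α n y = MvPolynomial.eval y (laguerreStarPoly α n) := by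
  have hS : 0 < ∑ i, y i := Finset.sum_pos (fun i _ => hy i) (by simp)
  have hJ := jacobiMulti_eq_eval hα (front n) (x := fun i => y i / ∑ i, y i)
    (fun i => (div_pos (hy i) hS).le) (fun i => div_pos (hy _) hS)
    (by rw [← Finset.sum_div, div_self hS.ne'])
  have hhom : MvPolynomial.eval y (jacobiPoly α (front n)) = (∑ i, y i) ^ (∑ j, front n j) *
      MvPolynomial.eval (fun i => y i / ∑ i, y i) (jacobiPoly α (front n)) := by
    have h := eval_alongRay (fun i => y i / ∑ i, y i) (∑ i, y i) (jacobiPoly α (front n))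
    simp only [div_mul_cancel₀ _ hS.ne'] at h
    rw [← h, alongRay_of_isHomogeneous _ (isHomogeneous_jacobiPoly α (front n))]
    rw [Polynomial.eval_mul, Polynomial.eval_C, Polynomial.eval_pow, Polynomial.eval_X, mul_comm]
  rw [laguerreStar, hJ, laguerre_eq_eval, laguerreStarPoly, map_mul, hhom, mul_assoc]
  congr 1
  rw [← MvPolynomial.coe_aeval_eq_eval, RingHom.coe_coe, ← Polynomial.aeval_algHom_apply, map_sum]
  simp only [MvPolynomial.aeval_X]
  rw [Polynomial.coe_aeval_eq_eval]

/-! ### Lauricella functions as Gamma means, and the connection formula -/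

/-- The product of the series `₁F₁(-m i; α i; y i)`. -/
noncomputable def kummerProd {k : ℕ} (α : Fin (k + 1) → ℝ) (m : Fin (k + 1) → ℕ) :
    MvPolynomial (Fin (k + 1)) ℝ :=
  ∏ i, Polynomial.aeval (MvPolynomial.X i) (kummer (m i) (α i))

theorem laguerreProdPoly_eq {k : ℕ} (α : Fin (k + 1) → ℝ) (m : Fin (k + 1) → ℕ) :
    laguerreProdPoly α m =
      MvPolynomial.C (∏ i, rising (α i) (m i) / (m i).factorial) * kummerProd α m := by
  rw [laguerreProdPoly, kummerProd, map_prod, ← Finset.prod_mul_distrib]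
  refine Finset.prod_congr rfl fun i _ => ?_
  rw [laguerrePoly, map_mul, Polynomial.aeval_C, MvPolynomial.algebraMap_eq]

theorem alongRay_kummerProd {k : ℕ} (α : Fin (k + 1) → ℝ) (m : Fin (k + 1) → ℕ)
    (x : Fin (k + 1) → ℝ) : alongRay x (kummerProd α m) =
      ∏ i, (kummer (m i) (α i)).comp (Polynomial.C (x i) * Polynomial.X) := by
  rw [kummerProd, map_prod]
  refine Finset.prod_congr rfl fun i _ => ?_
  rw [← Polynomial.aeval_algHom_apply, alongRay, MvPolynomial.aeval_X,
    Polynomial.comp_eq_aeval]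

/-- The appended parameters `-j`, `|α|` and argument `1` contribute the factor `kummer j`; the
others give the Kummer product along the ray through `t`. -/
theorem mixtureFA_eq {k : ℕ} (α : Fin (k + 1) → ℝ) (m : Fin (k + 1) → ℕ) (j : ℕ) (t : Fin k → ℝ) :
    mixtureFA α m j t = gammaFunctional (∑ i, α i)
      (kummer j (∑ i, α i) * alongRay (barycentric t) (kummerProd α m)) := by
  have h : (Fin.snoc (α := fun _ : Fin (k + 2) => ℝ)
      (fun i : Fin (k + 1) => -(m i : ℝ)) (-(j : ℝ))) =
      fun i => -((Fin.snoc (α := fun _ : Fin (k + 2) => ℕ) m j i : ℕ) : ℝ) := by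
    ext i
    induction i using Fin.lastCases with
    | last => simp
    | cast i => simp
  rw [mixtureFA, h, lauricellaFA_neg, Fin.prod_univ_castSucc, alongRay_kummerProd, mul_comm]
  simp only [Fin.snoc_castSucc, Fin.snoc_last, Polynomial.C_1, one_mul, Polynomial.comp_X]
  rfl

/-- Each `F_A` in `d_j` is the mean of a product of three Kummer polynomials, and the sum over `i`
reassembles `X ^ N`. -/
theorem weightD_eq {k : ℕ} {α : Fin (k + 1) → ℝ} (hα : ∀ i, 0 < α i) (n : Fin (k + 1) → ℕ) (j : ℕ) :
    weightD α n j = gammaFunctional (∑ i, α i)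
      (Polynomial.X ^ (∑ l, front n l) *
        laguerrePoly (n (Fin.last k)) (∑ i, α i + 2 * ((∑ l, front n l : ℕ) : ℝ)) *
          kummer j (∑ i, α i)) := by
  have ha : 0 < ∑ i, α i := Finset.sum_pos (fun i _ => hα i) (by simp)
  rw [weightD, X_pow_eq_sum_kummer ha, Finset.sum_mul, Finset.sum_mul, map_sum]
  refine Finset.sum_congr rfl fun i _ => ?_
  set N := ∑ l, front n l
  set a := ∑ i, α i
  have h : ![-(i : ℝ), -(n (Fin.last k) : ℝ), -(j : ℝ)] =
      fun l => -((![i, n (Fin.last k), j] l : ℕ) : ℝ) := by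
    ext l
    fin_cases l <;> rfl
  rw [h, lauricellaFA_neg, Fin.prod_univ_three, laguerrePoly]
  simp only [Matrix.cons_val,
    Polynomial.C_1, one_mul, Polynomial.comp_X]
  rw [show ∀ c d : ℝ, ∀ A B D : Polynomial ℝ, Polynomial.C c * A * (Polynomial.C d * B) * D =
    Polynomial.C (c * d) * (A * B * D) from fun c d A B D => by rw [map_mul]; ring,
    gammaFunctional_C_mul]
  congr 1
  field_simp

theorem jacobiMulti_ae_eq {k : ℕ} {α : Fin (k + 1) → ℝ} (hα : ∀ i, 0 < α i) (n : Fin k → ℕ) :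
    ∀ᵐ t ∂(dirichlet α),
      jacobiMulti α n t = MvPolynomial.eval (barycentric t) (jacobiPoly α n) := by
  filter_upwards [dirichlet_ae_pos α] with t ht
  rw [← jacobiMulti_eq_eval hα n (barycentric_nonneg ht.1)
    (fun i => by rw [barycentric_castSucc]; exact ht.2 i) (sum_barycentric t)]
  simp only [barycentric_castSucc]

theorem integrable_jacobiMulti_mul_mixtureFA {k : ℕ} {α : Fin (k + 1) → ℝ} (hα : ∀ i, 0 < α i)
    (m : Fin (k + 1) → ℕ) (n : Fin k → ℕ) (j : ℕ) :
    Integrable (fun t => jacobiMulti α n t * mixtureFA α m j t) (dirichlet α) := by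
  obtain ⟨F, hF⟩ := exists_eval_eq_gammaFunctional_mul_alongRay (∑ i, α i)
    (kummer j (∑ i, α i)) (kummerProd α m)
  refine (integrable_eval_barycentric hα (jacobiPoly α n * F)).congr ?_
  filter_upwards [jacobiMulti_ae_eq hα n] with t ht
  rw [ht, mixtureFA_eq, hF, map_mul]

theorem laguerreStar_mul_laguerreProd_ae_eq {k : ℕ} {α : Fin (k + 1) → ℝ} (hα : ∀ i, 0 < α i)
    (m n : Fin (k + 1) → ℕ) :
    (fun y => laguerreStar α n y * laguerreProd α m y) =ᵐ[gammaProd α]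
      fun y => MvPolynomial.eval y (laguerreStarPoly α n * laguerreProdPoly α m) := by
  filter_upwards [gammaProd_ae_pos hα] with y hy
  rw [laguerreStar_eq_eval hα n hy, laguerreProd_eq_eval, map_mul]

theorem connectionCoeff_eq {k : ℕ} {α : Fin (k + 1) → ℝ} (hα : ∀ i, 0 < α i)
    (m n : Fin (k + 1) → ℕ) :
    connectionCoeff α m n = gammaFunctionalMv α (laguerreStarPoly α n * laguerreProdPoly α m) := by
  rw [connectionCoeff, integral_congr_ae (laguerreStar_mul_laguerreProd_ae_eq hα m n),
    (integrable_integral_eval_gammaProd hα _).2]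

theorem alongRay_aeval_sum_X {k : ℕ} (t : Fin k → ℝ) (q : Polynomial ℝ) :
    alongRay (barycentric t) (Polynomial.aeval (∑ i, MvPolynomial.X i) q) = q := by
  rw [← Polynomial.aeval_algHom_apply, map_sum]
  simp only [alongRay, MvPolynomial.aeval_X]
  rw [← Finset.sum_mul, ← map_sum, sum_barycentric, Polynomial.C_1, one_mul, Polynomial.aeval_X_left,
    AlgHom.id_apply]

/-- The identity already holds pointwise in `t`, after averaging over the total mass, and for all
`m` and `n`; `|m| = |n|` matters only for the prefactor. -/
theorem sum_weightD_mul_integral {k : ℕ} {α : Fin (k + 1) → ℝ} (hα : ∀ i, 0 < α i)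
    (m n : Fin (k + 1) → ℕ) :
    ∑ j ∈ Finset.range (∑ i, n i + 1), rising (∑ i, α i) j / (j.factorial : ℝ) * weightD α n j *
        ∫ t, jacobiMulti α (front n) t * mixtureFA α m j t ∂(dirichlet α) =
      gammaFunctionalMv α (laguerreStarPoly α n * kummerProd α m) := by
  have ha : 0 < ∑ i, α i := Finset.sum_pos (fun i _ => hα i) (by simp)
  rw [← (integrable_integral_gammaFunctional_alongRay hα _).2]
  simp only [← integral_const_mul]
  rw [← integral_finsetSum _ fun j _ =>
    (integrable_jacobiMulti_mul_mixtureFA hα m (front n) j).const_mul _]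
  refine integral_congr_ae ?_
  filter_upwards [jacobiMulti_ae_eq hα (front n)] with t ht
  set a := ∑ i, α i
  -- The radial part. Its degree bound is why the sum over `j` may stop at `|n|`.
  set Q : Polynomial ℝ := Polynomial.X ^ (∑ l, front n l) *
    laguerrePoly (n (Fin.last k)) (a + 2 * ((∑ l, front n l : ℕ) : ℝ)) with hQ
  have hdeg : Q.natDegree ≤ ∑ i, n i := by
    rw [← sum_front_add_last]
    refine Polynomial.natDegree_mul_le.trans (add_le_add ?_ (laguerrePoly_natDegree_le _ _))
    simp
  set W := alongRay (barycentric t) (kummerProd α m)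
  have h1 : alongRay (barycentric t) (laguerreStarPoly α n * kummerProd α m) =
      Polynomial.C (jacobiMulti α (front n) t) * (Q * W) := by
    rw [map_mul, laguerreStarPoly, map_mul, alongRay_aeval_sum_X,
      alongRay_of_isHomogeneous _ (isHomogeneous_jacobiPoly α (front n)), ← ht, hQ]
    ring
  rw [h1, gammaFunctional_C_mul]
  conv_rhs => rw [← sum_gammaFunctional_mul_kummer ha hdeg]
  rw [Finset.sum_mul, map_sum, Finset.mul_sum]
  refine Finset.sum_congr rfl fun j _ => ?_
  rw [mul_assoc (Polynomial.C _), gammaFunctional_C_mul, mixtureFA_eq, weightD_eq hα]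
  ring

theorem proposition4p3 (k : ℕ) (α : Fin (k + 1) → ℝ) (hα : ∀ i, 0 < α i)
    (m n : Fin (k + 1) → ℕ) :
    Integrable (fun y => laguerreStar α n y * laguerreProd α m y) (gammaProd α) ∧
    (∀ j : ℕ, Integrable (fun t => jacobiMulti α (front n) t * mixtureFA α m j t) (dirichlet α)) ∧
    connectionCoeff α m n =
      (if ∑ i, m i = ∑ i, n i then (1 : ℝ) else 0) *
        (rising (∑ i, α i) (∑ i, n i) / ((∑ i, n i).factorial : ℝ)) * dirichletMultinomial α m *
        ∑ j ∈ Finset.range (∑ i, n i + 1),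
          rising (∑ i, α i) j / (j.factorial : ℝ) * weightD α n j *
            ∫ t, jacobiMulti α (front n) t * mixtureFA α m j t ∂(dirichlet α) := by
  refine ⟨(integrable_integral_eval_gammaProd hα _).1.congr
    (laguerreStar_mul_laguerreProd_ae_eq hα m n).symm,
    integrable_jacobiMulti_mul_mixtureFA hα m (front n), ?_⟩
  rw [connectionCoeff_eq hα]
  split_ifs with h
  · have ha : 0 < ∑ i, α i := Finset.sum_pos (fun i _ => hα i) (by simp)
    -- When `|m| = |n|`, the factorial and rising factorial of `|n|` cancel those in the
    -- Dirichlet-multinomial weight, leaving the constant between the Laguerre and Kummer products.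
    have hconst : 1 * (rising (∑ i, α i) (∑ i, n i) / ((∑ i, n i).factorial : ℝ)) *
        dirichletMultinomial α m = ∏ i, rising (α i) (m i) / (m i).factorial := by
      have h1 := (rising_pos ha (∑ i, n i)).ne'
      have h2 : (∏ i, ((m i).factorial : ℝ)) * Nat.multinomial Finset.univ m =
          (∑ i, n i).factorial := by
        rw [← h]
        exact_mod_cast Nat.multinomial_spec Finset.univ m
      have h3 : ∏ i, ((m i).factorial : ℝ) ≠ 0 := Finset.prod_ne_zero_iff.2 fun i _ => by positivity
      have h4 : (Nat.multinomial Finset.univ m : ℝ) ≠ 0 := by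
        intro h0
        rw [h0, mul_zero] at h2
        exact absurd h2.symm (by positivity)
      rw [dirichletMultinomial, Finset.prod_div_distrib, ← h2, h]
      field_simp
    rw [sum_weightD_mul_integral hα, hconst, laguerreProdPoly_eq, mul_left_comm,
      gammaFunctionalMv_C_mul]
  · rw [gammaFunctionalMv_laguerreStar_mul_laguerreProd_eq_zero hα m n h]
    simp
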